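/- Let $(X,d)$ be a metric space and let $\mu$ be a $\sigma$-finite Borel regular measure on $X$, that is, a measure on a $\sigma$-algebra containing the Borel sets such that every measurable set $A$ is contained in a Borel set $B$ with $\mu(B)=\mu(A)$. Let $1\le p<\infty$. Measurability of functions refers to the $\sigma$-algebra of $\mu$ unless "Borel" is said. *Test curves.* A test curve is a map $\gamma:[0,1]\to X$ of finite variation $V(\gamma)$ that is right-continuous on $[0,1)$, left-continuous at $1$, and such that $\gamma(t^-)=\lim_{s\to t^-}\gamma(s)$ exists in $X$ for all $t\in(0,1)$; it is nontrivial if $V(\gamma)>0$. Put $\gamma(0^-)=\gamma(0)$ and let $\overleftarrow\gamma(t)=\gamma((1-t)^-)$ be the reversed test curve. Let $V_\gamma(t)$ be the variation of $\gamma$ on $[0,t]$ and let $\mu_\gamma$ be the Borel measure on $[0,1]$ with $\mu_\gamma((r,t])=V_\gamma(t)-V_\gamma(r)$ and $\mu_\gamma(\{0\})=0$. For Borel $g:X\to[0,\infty]$ put $\int_\gamma g=\int_{[0,1]}g\circ\gamma\,d\mu_\gamma$ and $\int^S_\gamma g=\frac12\big(\int_\gamma g+\int_{\overleftarrow\gamma}g\big)$.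 *The TC-Newtonian space.* For a family $\Gamma$ of nontrivial test curves let $\mathrm{Mod}^p(\Gamma)=\inf_\rho\|\rho\|_{L^p(\mu)}^p$, the infimum being over all Borel $\rho:X\to[0,\infty]$ with $\int^S_\gamma\rho\ge1$ for every $\gamma\in\Gamma$. A Borel function $g:X\to[0,\infty]$ is a $p$-weak upper $S$-gradient of $f:X\to\mathbb R$ if the family of nontrivial test curves $\gamma$ for which $|f(\gamma(1))-f(\gamma(0))|\le\int^S_\gamma g$ fails has $\mathrm{Mod}^p$ equal to $0$. Let $\tilde N^{1,p}_{TC}(X)$ be the space of measurable $f:X\to\mathbb R$ with $\int_X|f|^p\,d\mu<\infty$ that have a $p$-weak upper $S$-gradient in $L^p(\mu)$, with the seminorm $\|f\|_{N^{1,p}_{TC}}=\|f\|_{L^p(\mu)}+\inf_g\|g\|_{L^p(\mu)}$, the infimum being over all $p$-weak upper $S$-gradients $g$ of $f$. The TC-Newtonian space $N^{1,p}_{TC}(X)$ is the quotient of $\tilde N^{1,p}_{TC}(X)$ by the relation $\|f-f'\|_{N^{1,p}_{TC}}=0$, with the induced norm. *The Hajłasz–Sobolev space.* A measurable $g:X\to[0,\infty]$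 is a Hajłasz gradient of an a.e. finite measurable function $f$ if there is a measurable set $E$ with $\mu(E)=0$ such that $|f(y)-f(x)|\le(g(x)+g(y))\,d(x,y)$ for all $x,y\in X\setminus E$. The space $M^{1,p}(X)$ consists of the $f\in L^p(\mu)$ (functions equal a.e. being identified) that have a Hajłasz gradient in $L^p(\mu)$, with the norm $\|f\|_{M^{1,p}}=\|f\|_{L^p(\mu)}+\inf_g\|g\|_{L^p(\mu)}$, the infimum being over all Hajłasz gradients $g$ of $f$. **Theorem.** $M^{1,p}(X)$ and $N^{1,p}_{TC}(X)$ are isomorphic as normed spaces: sending the class in $N^{1,p}_{TC}(X)$ of a function $f\in\tilde N^{1,p}_{TC}(X)$ to its $\mu$-a.e. equivalence class is a well-defined linear bijection from $N^{1,p}_{TC}(X)$ onto $M^{1,p}(X)$ which is bounded and has a bounded inverse. -/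

import Mathlib

open MeasureTheory Set Filter Topology
open scoped ENNReal unitInterval

noncomputable section

/-- A test curve in `X`: a map `γ : [0,1] → X` of bounded variation that is right-continuous,
left-continuous at `1`, and has a left limit in `X` at every interior point. -/
structure TestCurve (X : Type*) [MetricSpace X] where
  toFun : I → X
  boundedVariation : BoundedVariationOn toFun univ
  rightContinuous : ∀ t : I, t < 1 → ContinuousWithinAt toFun (Ici t) t
  leftContinuous_one : ContinuousWithinAt toFun (Iic 1) 1
  exists_leftLim : ∀ t : I, 0 < t → t < 1 → ∃ x, Tendsto toFun (𝓝[<] t) (𝓝 x)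

namespace TestCurve

variable {X : Type*} [MetricSpace X]

instance : CoeFun (TestCurve X) fun _ => I → X := ⟨TestCurve.toFun⟩

theorem continuousWithinAt_Ici (γ : TestCurve X) (t : I) : ContinuousWithinAt γ (Ici t) t := by
  rcases lt_or_ge t 1 with h | h
  · exact γ.rightContinuous t h
  · have ht : t = 1 := le_antisymm unitInterval.le_one' h
    have : Ici t = {t} := by
      ext s
      simp only [mem_Ici, mem_singleton_iff]
      exact ⟨fun hs => le_antisymm (ht ▸ unitInterval.le_one') hs, fun hs => hs.ge⟩
    rw [this]
    exact continuousWithinAt_singleton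

theorem tendsto_leftLim (γ : TestCurve X) (t : I) :
    Tendsto γ (𝓝[<] t) (𝓝 (Function.leftLim γ t)) := by
  apply tendsto_leftLim_of_tendsto
  rcases (unitInterval.nonneg' (t := t)).eq_or_lt with h0 | h0
  · refine ⟨γ t, ?_⟩
    have : Iio t = ∅ := by
      rw [← h0]
      ext s
      simp
    simp [this]
  · rcases (unitInterval.le_one' (t := t)).eq_or_lt with h1 | h1
    · subst h1
      exact ⟨γ 1, γ.leftContinuous_one.tendsto.mono_left (nhdsWithin_mono _ Iio_subset_Iic_self)⟩
    · exact γ.exists_leftLim t h0 h1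

theorem tendsto_leftLim_right (γ : TestCurve X) (t : I) (ht : t < 1) :
    Tendsto (Function.leftLim γ) (𝓝[>] t) (𝓝 (γ t)) := by
  have hc : Tendsto γ (𝓝[>] t) (𝓝 (γ t)) :=
    (γ.continuousWithinAt_Ici t).tendsto.mono_left (nhdsWithin_mono _ Ioi_subset_Ici_self)
  refine (closed_nhds_basis (γ t)).tendsto_right_iff.2 ?_
  rintro s ⟨hs, hsc⟩
  obtain ⟨u, htu, hu⟩ : ∃ u, t < u ∧ Ioo t u ⊆ {x | γ x ∈ s} := by
    have := (closed_nhds_basis (γ t)).tendsto_right_iff.1 hc s ⟨hs, hsc⟩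
    simpa using (mem_nhdsGT_iff_exists_Ioo_subset' ht).1 this
  filter_upwards [Ioo_mem_nhdsGT htu] with c hc
  have : (𝓝[<] c).NeBot := nhdsLT_neBot_of_exists_lt ⟨t, hc.1⟩
  refine hsc.mem_of_tendsto (γ.tendsto_leftLim c) ?_
  filter_upwards [Ioo_mem_nhdsLT hc.1] with d hd
  exact hu ⟨hd.1, hd.2.trans hc.2⟩

theorem tendsto_symm_Ioi (t : I) : Tendsto unitInterval.symm (𝓝[>] t) (𝓝[<] (unitInterval.symm t)) :=
  tendsto_nhdsWithin_iff.2
    ⟨(unitInterval.continuous_symm.tendsto t).mono_left nhdsWithin_le_nhds,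
      by filter_upwards [self_mem_nhdsWithin] with s hs; simpa using hs⟩

theorem tendsto_symm_Iio (t : I) : Tendsto unitInterval.symm (𝓝[<] t) (𝓝[>] (unitInterval.symm t)) :=
  tendsto_nhdsWithin_iff.2
    ⟨(unitInterval.continuous_symm.tendsto t).mono_left nhdsWithin_le_nhds,
      by filter_upwards [self_mem_nhdsWithin] with s hs; simpa using hs⟩

theorem tendsto_reverse_left (γ : TestCurve X) (t : I) (ht : 0 < t) :
    Tendsto (fun t => Function.leftLim γ (unitInterval.symm t)) (𝓝[<] t)
      (𝓝 (γ (unitInterval.symm t))) :=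
  (γ.tendsto_leftLim_right (unitInterval.symm t)
    (by
      rw [← unitInterval.symm_zero]
      exact unitInterval.strictAnti_symm ht)).comp (tendsto_symm_Iio t)

/-- The reversal `t ↦ γ((1 - t)⁻)` of a test curve, with the convention `γ(0⁻) = γ(0)`
(which is built into `Function.leftLim`). -/
def reverse (γ : TestCurve X) : TestCurve X where
  toFun t := Function.leftLim γ (unitInterval.symm t)
  boundedVariation := by
    have h := γ.boundedVariation.leftLim
    have h2 := eVariationOn.comp_le_of_antitoneOn (Function.leftLim γ.toFun) (s := univ)
      (t := univ) unitInterval.symm (fun a _ b _ hab => by simpa using hab) (fun _ _ => mem_univ _)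
    exact (h2.trans_lt h.lt_top).ne
  rightContinuous t _ := by
    have h := continuousWithinAt_leftLim_Iic (γ.tendsto_leftLim (unitInterval.symm t))
    exact ContinuousWithinAt.comp h unitInterval.continuous_symm.continuousWithinAt
      (fun s hs => by simpa using hs)
  leftContinuous_one := by
    have h := γ.tendsto_reverse_left 1 zero_lt_one
    have h0 : γ (unitInterval.symm 1) = Function.leftLim γ (unitInterval.symm 1) := by
      rw [leftLim_eq_of_isBot]
      intro x
      simp
    rw [h0] at h
    exact continuousWithinAt_Iio_iff_Iic.1 h
  exists_leftLim t ht _ := ⟨_, γ.tendsto_reverse_left t ht⟩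

/-- The variation function `V_γ(t)`, the variation of `γ` on `[0,t]`; it is nondecreasing and
right-continuous. -/
def variationFunction (γ : TestCurve X) : StieltjesFunction I where
  toFun t := (eVariationOn γ (Icc 0 t)).toReal
  mono' s t hst := ENNReal.toReal_mono
    (γ.boundedVariation.mono (subset_univ _)) (eVariationOn.mono _ (Icc_subset_Icc_right hst))
  right_continuous' t := by
    have h := γ.boundedVariation.continuousWithinAt_variationOnFromTo_Ici (a := 0)
      (γ.continuousWithinAt_Ici t)
    have e : (fun t : I => (eVariationOn γ (Icc 0 t)).toReal) = variationOnFromTo γ univ 0 := by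
      funext s
      rw [variationOnFromTo.eq_of_le _ _ unitInterval.nonneg', univ_inter]
    rw [e]
    exact h

/-- The Lebesgue–Stieltjes measure `μ_γ` on `[0,1]` induced by `V_γ`: it satisfies
`μ_γ((r,t]) = V_γ(t) - V_γ(r)` and `μ_γ({0}) = 0`. -/
def variationMeasure (γ : TestCurve X) : Measure I := γ.variationFunction.measure

/-- The Lebesgue–Stieltjes integral `∫_γ g` of a nonnegative Borel function. -/
def integral (γ : TestCurve X) (g : X → ℝ≥0∞) : ℝ≥0∞ := ∫⁻ t, g (γ t) ∂γ.variationMeasure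

/-- The symmetrized integral `∫^S_γ g`. -/
def symmIntegral (γ : TestCurve X) (g : X → ℝ≥0∞) : ℝ≥0∞ :=
  (γ.integral g + γ.reverse.integral g) / 2

/-- A test curve is nontrivial if its variation is nonzero. -/
def IsNontrivial (γ : TestCurve X) : Prop := 0 < eVariationOn γ univ

theorem integral_mono (γ : TestCurve X) {g h : X → ℝ≥0∞} (H : ∀ x, g x ≤ h x) :
    γ.integral g ≤ γ.integral h := lintegral_mono fun _ => H _

theorem symmIntegral_mono (γ : TestCurve X) {g h : X → ℝ≥0∞} (H : ∀ x, g x ≤ h x) :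
    γ.symmIntegral g ≤ γ.symmIntegral h :=
  ENNReal.div_le_div_right (add_le_add (γ.integral_mono H) (γ.reverse.integral_mono H)) 2

theorem symmIntegral_add_le (γ : TestCurve X) (g h : X → ℝ≥0∞) :
    γ.symmIntegral g + γ.symmIntegral h ≤ γ.symmIntegral (g + h) := by
  unfold symmIntegral
  rw [← ENNReal.add_div]
  refine ENNReal.div_le_div_right ?_ 2
  rw [add_add_add_comm]
  exact add_le_add (le_lintegral_add _ _) (le_lintegral_add _ _)

theorem symmIntegral_const_mul_le (γ : TestCurve X) (c : ℝ≥0∞) (g : X → ℝ≥0∞) :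
    c * γ.symmIntegral g ≤ γ.symmIntegral (fun x => c * g x) := by
  unfold symmIntegral
  rw [← mul_div_assoc, mul_add]
  exact ENNReal.div_le_div_right
    (add_le_add (lintegral_const_mul_le _ _) (lintegral_const_mul_le _ _)) 2

end TestCurve

variable {X : Type*} [MetricSpace X] [MeasurableSpace X]

/-- Borel regularity. The measure `μ` lives on a σ-algebra containing the Borel sets, and every
measurable set has a Borel superset of the same measure. -/
def IsBorelRegular (μ : Measure X) : Prop :=
  ∀ A : Set X, MeasurableSet A → ∃ B : Set X, A ⊆ B ∧ MeasurableSet[borel X] B ∧ μ B = μ A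

/-- The `p`-modulus of a family of test curves. -/
def modulus (μ : Measure X) (p : ℝ≥0∞) (Γ : Set (TestCurve X)) : ℝ≥0∞ :=
  ⨅ (ρ : X → ℝ≥0∞) (_ : Measurable[borel X] ρ ∧ ∀ γ ∈ Γ, 1 ≤ γ.symmIntegral ρ),
    eLpNorm ρ p μ ^ p.toReal

/-- A property holds for `p`-modulus almost every nontrivial test curve. -/
def ModulusAE (μ : Measure X) (p : ℝ≥0∞) (P : TestCurve X → Prop) : Prop :=
  modulus μ p {γ | γ.IsNontrivial ∧ ¬ P γ} = 0

/-- `g` is a `p`-weak upper `S`-gradient of `f`. -/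
def IsWeakUpperSGradient (μ : Measure X) (p : ℝ≥0∞) (f : X → ℝ) (g : X → ℝ≥0∞) : Prop :=
  Measurable[borel X] g ∧
    ModulusAE μ p fun γ => ENNReal.ofReal |f (γ 1) - f (γ 0)| ≤ γ.symmIntegral g

/-- `g` is a Hajłasz gradient of `f`. -/
def IsHajlaszGradient (μ : Measure X) (f : X → ℝ) (g : X → ℝ≥0∞) : Prop :=
  Measurable g ∧ ∃ E : Set X, MeasurableSet E ∧ μ E = 0 ∧ ∀ x ∉ E, ∀ y ∉ E,
    ENNReal.ofReal |f y - f x| ≤ (g x + g y) * edist x y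

/-- The infimum of the `L^p` norms over a set of `[0,∞]`-valued functions. -/
def infLpNorm (μ : Measure X) (p : ℝ≥0∞) (G : Set (X → ℝ≥0∞)) : ℝ≥0∞ :=
  ⨅ g ∈ G, eLpNorm g p μ

section Aux

variable {μ : Measure X} {p : ℝ≥0∞}

theorem ModulusAE.of_forall [hp1 : Fact (1 ≤ p)] [hp : Fact (p ≠ ∞)] {P : TestCurve X → Prop}
    (h : ∀ γ, P γ) : ModulusAE μ p P := by
  unfold ModulusAE modulus
  have hp0 : 0 < p.toReal := ENNReal.toReal_pos (zero_lt_one.trans_le hp1.out).ne' hp.out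
  refine le_antisymm (iInf₂_le_of_le 0 ⟨@measurable_const _ _ _ (borel X) 0, ?_⟩ ?_) zero_le
  · rintro γ ⟨-, hγ⟩
    exact (hγ (h γ)).elim
  · simp [hp0]

theorem eLpNorm_add_le_borel [OpensMeasurableSpace X] [hp1 : Fact (1 ≤ p)] {g h : X → ℝ≥0∞}
    (hg : Measurable g) (hh : Measurable h) :
    eLpNorm (g + h) p μ ≤ eLpNorm g p μ + eLpNorm h p μ :=
  eLpNorm_add_le hg.aestronglyMeasurable hh.aestronglyMeasurable hp1.out

theorem Measurable.of_borel [OpensMeasurableSpace X] {g : X → ℝ≥0∞}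
    (hg : Measurable[borel X] g) : Measurable g :=
  hg.mono OpensMeasurableSpace.borel_le le_rfl

theorem ModulusAE.mono_and [OpensMeasurableSpace X] [hp1 : Fact (1 ≤ p)] [hp : Fact (p ≠ ∞)]
    {P Q R : TestCurve X → Prop} (hP : ModulusAE μ p P) (hQ : ModulusAE μ p Q)
    (h : ∀ γ, P γ → Q γ → R γ) : ModulusAE μ p R := by
  have hp0 : 0 < p.toReal := ENNReal.toReal_pos (zero_lt_one.trans_le hp1.out).ne' hp.out
  have key : ∀ {P : TestCurve X → Prop}, ModulusAE μ p P → ∀ ε : ℝ≥0∞, 0 < ε →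
      ∃ ρ : X → ℝ≥0∞, (Measurable[borel X] ρ ∧
        ∀ γ ∈ {γ : TestCurve X | γ.IsNontrivial ∧ ¬ P γ}, 1 ≤ γ.symmIntegral ρ) ∧
          eLpNorm ρ p μ < ε := by
    intro P hP ε hε
    have h0 : modulus μ p {γ | γ.IsNontrivial ∧ ¬ P γ} < ε ^ p.toReal := by
      rw [show modulus μ p {γ | γ.IsNontrivial ∧ ¬ P γ} = 0 from hP]
      exact ENNReal.rpow_pos_of_nonneg hε hp0.le
    unfold modulus at h0
    simp only [iInf_lt_iff] at h0
    obtain ⟨ρ, hρ, hlt⟩ := h0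
    exact ⟨ρ, hρ, (ENNReal.rpow_lt_rpow_iff hp0).1 hlt⟩
  refine nonpos_iff_eq_zero.1 (le_of_forall_pos_le_add fun ε hε => ?_)
  rw [zero_add]
  have hδ : 0 < ε ^ (1 / p.toReal) := ENNReal.rpow_pos_of_nonneg hε (by positivity)
  have hδ2 : 0 < ε ^ (1 / p.toReal) / 2 := ENNReal.half_pos hδ.ne'
  obtain ⟨ρ, ⟨hρm, hρ⟩, hρlt⟩ := key hP _ hδ2
  obtain ⟨τ, ⟨hτm, hτ⟩, hτlt⟩ := key hQ _ hδ2
  refine iInf₂_le_of_le (ρ + τ) ⟨hρm.add hτm, ?_⟩ ?_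
  · rintro γ ⟨hγ, hR⟩
    by_cases hPγ : P γ
    · have hQγ : ¬ Q γ := fun hQγ => hR (h γ hPγ hQγ)
      exact (hτ γ ⟨hγ, hQγ⟩).trans (γ.symmIntegral_mono fun x => le_add_self)
    · exact (hρ γ ⟨hγ, hPγ⟩).trans (γ.symmIntegral_mono fun x => le_self_add)
  · have h1 : eLpNorm (ρ + τ) p μ ≤ ε ^ (1 / p.toReal) := by
      refine (eLpNorm_add_le_borel (Measurable.of_borel hρm) (Measurable.of_borel hτm)).trans ?_
      rw [← ENNReal.add_halves (ε ^ (1 / p.toReal))]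
      exact add_le_add hρlt.le hτlt.le
    calc eLpNorm (ρ + τ) p μ ^ p.toReal ≤ (ε ^ (1 / p.toReal)) ^ p.toReal :=
          ENNReal.rpow_le_rpow h1 hp0.le
      _ = ε := by rw [← ENNReal.rpow_mul, one_div_mul_cancel hp0.ne', ENNReal.rpow_one]

theorem ofReal_abs_add_sub_le (a b c d : ℝ) :
    ENNReal.ofReal |(a + b) - (c + d)| ≤ ENNReal.ofReal |a - c| + ENNReal.ofReal |b - d| := by
  rw [← ENNReal.ofReal_add (abs_nonneg _) (abs_nonneg _), add_sub_add_comm]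
  exact ENNReal.ofReal_le_ofReal (abs_add_le _ _)

theorem ofReal_abs_mul_sub (r a c : ℝ) :
    ENNReal.ofReal |r * a - r * c| = ‖r‖ₑ * ENNReal.ofReal |a - c| := by
  rw [← mul_sub, abs_mul, ENNReal.ofReal_mul (abs_nonneg _), ← Real.enorm_eq_ofReal_abs]

theorem IsWeakUpperSGradient.zero [Fact (1 ≤ p)] [Fact (p ≠ ∞)] :
    IsWeakUpperSGradient μ p (0 : X → ℝ) 0 :=
  ⟨@measurable_const _ _ _ (borel X) 0, ModulusAE.of_forall fun γ => by simp⟩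

theorem IsWeakUpperSGradient.add [OpensMeasurableSpace X] [Fact (1 ≤ p)] [Fact (p ≠ ∞)]
    {f f' : X → ℝ} {g g' : X → ℝ≥0∞}
    (h : IsWeakUpperSGradient μ p f g) (h' : IsWeakUpperSGradient μ p f' g') :
    IsWeakUpperSGradient μ p (f + f') (g + g') :=
  ⟨h.1.add h'.1, h.2.mono_and h'.2 fun γ hγ hγ' =>
    (ofReal_abs_add_sub_le _ _ _ _).trans
      ((add_le_add hγ hγ').trans (γ.symmIntegral_add_le g g'))⟩

theorem IsWeakUpperSGradient.smul [OpensMeasurableSpace X] [Fact (1 ≤ p)] [Fact (p ≠ ∞)]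
    {f : X → ℝ} {g : X → ℝ≥0∞} (h : IsWeakUpperSGradient μ p f g) (r : ℝ) :
    IsWeakUpperSGradient μ p (r • f) (fun x => ‖r‖ₑ * g x) :=
  ⟨h.1.const_mul _, h.2.mono_and h.2 fun γ hγ _ => by
    simp only [Pi.smul_apply, smul_eq_mul]
    rw [ofReal_abs_mul_sub]
    exact (mul_le_mul_right hγ _).trans (γ.symmIntegral_const_mul_le _ g)⟩

theorem IsHajlaszGradient.congr {f f' : X → ℝ} {g : X → ℝ≥0∞} (h : IsHajlaszGradient μ f g)
    (hf : f =ᵐ[μ] f') : IsHajlaszGradient μ f' g := by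
  obtain ⟨hg, E, hE, hE0, H⟩ := h
  have hN : μ {x | ¬ f x = f' x} = 0 := hf
  refine ⟨hg, E ∪ toMeasurable μ {x | ¬ f x = f' x},
    hE.union (measurableSet_toMeasurable _ _), ?_, fun x hx y hy => ?_⟩
  · exact measure_union_null hE0 (by rw [measure_toMeasurable, hN])
  · have hsub := subset_toMeasurable μ {x | ¬ f x = f' x}
    have h1 : f x = f' x := by
      by_contra hne
      exact hx (Or.inr (hsub hne))
    have h2 : f y = f' y := by
      by_contra hne
      exact hy (Or.inr (hsub hne))
    rw [← h1, ← h2]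
    exact H x (fun hx' => hx (Or.inl hx')) y (fun hy' => hy (Or.inl hy'))

theorem IsHajlaszGradient.zero : IsHajlaszGradient μ (0 : X → ℝ) 0 :=
  ⟨measurable_const, ∅, MeasurableSet.empty, measure_empty, by simp⟩

theorem IsHajlaszGradient.add {f f' : X → ℝ} {g g' : X → ℝ≥0∞}
    (h : IsHajlaszGradient μ f g) (h' : IsHajlaszGradient μ f' g') :
    IsHajlaszGradient μ (f + f') (g + g') := by
  obtain ⟨hg, E, hE, hE0, H⟩ := h
  obtain ⟨hg', E', hE', hE0', H'⟩ := h'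
  refine ⟨hg.add hg', E ∪ E', hE.union hE', measure_union_null hE0 hE0', fun x hx y hy => ?_⟩
  refine (ofReal_abs_add_sub_le _ _ _ _).trans
    ((add_le_add (H x (fun k => hx (Or.inl k)) y (fun k => hy (Or.inl k)))
      (H' x (fun k => hx (Or.inr k)) y (fun k => hy (Or.inr k)))).trans (le_of_eq ?_))
  simp only [Pi.add_apply]
  ring

theorem IsHajlaszGradient.smul {f : X → ℝ} {g : X → ℝ≥0∞} (h : IsHajlaszGradient μ f g) (r : ℝ) :
    IsHajlaszGradient μ (r • f) (fun x => ‖r‖ₑ * g x) := by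
  obtain ⟨hg, E, hE, hE0, H⟩ := h
  refine ⟨hg.const_mul _, E, hE, hE0, fun x hx y hy => ?_⟩
  simp only [Pi.smul_apply, smul_eq_mul]
  rw [ofReal_abs_mul_sub, ← mul_add, mul_assoc]
  exact mul_le_mul_right (H x hx y hy) _

theorem eLpNorm_const_mul_le_ennreal (r : ℝ) (g : X → ℝ≥0∞) :
    eLpNorm (fun x => ‖r‖ₑ * g x) p μ ≤ ‖r‖ₑ * eLpNorm g p μ :=
  eLpNorm_le_nnreal_smul_eLpNorm_of_ae_le_mul' (c := ‖r‖₊) (ae_of_all _ fun _ => le_rfl) p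

theorem infLpNorm_lt_top {G : Set (X → ℝ≥0∞)} (h : ∃ g ∈ G, eLpNorm g p μ < ∞) :
    infLpNorm μ p G < ∞ := by
  obtain ⟨g, hg, hlt⟩ := h
  exact (iInf₂_le g hg).trans_lt hlt

theorem infLpNorm_add_le [Fact (1 ≤ p)] {G G' G'' : Set (X → ℝ≥0∞)} (hG : ∀ g ∈ G, Measurable g)
    (hG' : ∀ g ∈ G', Measurable g) (h : ∀ g ∈ G, ∀ g' ∈ G', g + g' ∈ G'') :
    infLpNorm μ p G'' ≤ infLpNorm μ p G + infLpNorm μ p G' := by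
  unfold infLpNorm
  refine ENNReal.le_iInf₂_add_iInf₂ fun g hg g' hg' => (iInf₂_le (g + g') (h g hg g' hg')).trans
    (eLpNorm_add_le (hG g hg).aestronglyMeasurable (hG' g' hg').aestronglyMeasurable Fact.out)

theorem infLpNorm_smul_le {G G' : Set (X → ℝ≥0∞)} (r : ℝ)
    (h : ∀ g ∈ G, (fun x => ‖r‖ₑ * g x) ∈ G') (hG : infLpNorm μ p G < ∞) :
    infLpNorm μ p G' ≤ ‖r‖ₑ * infLpNorm μ p G := by
  refine ENNReal.le_of_forall_pos_le_add fun ε hε _ => ?_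
  by_cases hr : r = 0
  · subst hr
    simp only [infLpNorm, iInf_lt_iff] at hG
    obtain ⟨g, hg, -⟩ := hG
    refine (iInf₂_le _ (h g hg)).trans ((eLpNorm_const_mul_le_ennreal _ _).trans ?_)
    simp
  · have hr0 : ‖r‖ₑ ≠ 0 := by simpa using hr
    unfold infLpNorm
    rw [ENNReal.mul_iInf_of_ne hr0 enorm_ne_top]
    refine le_add_of_le_left (le_iInf fun g => ?_)
    by_cases hg : g ∈ G
    · simp only [hg, iInf_pos]
      exact (iInf₂_le _ (h g hg)).trans (eLpNorm_const_mul_le_ennreal _ _)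
    · simp [hg, ENNReal.mul_top hr0]

end Aux

/-- The set of `p`-weak upper `S`-gradients of `f`. -/
def weakUpperSGradients (μ : Measure X) (p : ℝ≥0∞) (f : X → ℝ) : Set (X → ℝ≥0∞) :=
  {g | IsWeakUpperSGradient μ p f g}

/-- The set of Hajłasz gradients of `f`. -/
def hajlaszGradients (μ : Measure X) (f : X → ℝ) : Set (X → ℝ≥0∞) :=
  {g | IsHajlaszGradient μ f g}

/-- The functions `f : X → ℝ` in `L^p(μ)` having a `p`-weak upper `S`-gradient in `L^p(μ)`. -/
def tcNewtonianSubmodule (μ : Measure X) (p : ℝ≥0∞) [OpensMeasurableSpace X] [Fact (1 ≤ p)]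
    [Fact (p ≠ ∞)] : Submodule ℝ (X → ℝ) where
  carrier := {f | Measurable f ∧ eLpNorm f p μ < ∞ ∧
    ∃ g ∈ weakUpperSGradients μ p f, eLpNorm g p μ < ∞}
  zero_mem' := ⟨measurable_const, by simp, 0, IsWeakUpperSGradient.zero, by simp⟩
  add_mem' := by
    rintro f f' ⟨hf, hfp, g, hg, hgp⟩ ⟨hf', hfp', g', hg', hgp'⟩
    refine ⟨hf.add hf', ?_, g + g', IsWeakUpperSGradient.add hg hg', ?_⟩
    · exact (eLpNorm_add_le hf.aestronglyMeasurable hf'.aestronglyMeasurable Fact.out).trans_lt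
        (ENNReal.add_lt_top.2 ⟨hfp, hfp'⟩)
    · exact (eLpNorm_add_le_borel (Measurable.of_borel hg.1) (Measurable.of_borel hg'.1)).trans_lt
        (ENNReal.add_lt_top.2 ⟨hgp, hgp'⟩)
  smul_mem' := by
    rintro r f ⟨hf, hfp, g, hg, hgp⟩
    refine ⟨hf.const_smul r, ?_, _, IsWeakUpperSGradient.smul hg r, ?_⟩
    · rw [eLpNorm_const_smul]
      exact ENNReal.mul_lt_top enorm_lt_top hfp
    · exact (eLpNorm_const_mul_le_ennreal r g).trans_lt (ENNReal.mul_lt_top enorm_lt_top hgp)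

/-- The space of functions underlying the TC-Newtonian space, before passing to the quotient. -/
def TCNewtonianPre (μ : Measure X) (p : ℝ≥0∞) [OpensMeasurableSpace X] [Fact (1 ≤ p)]
    [Fact (p ≠ ∞)] : Type _ := tcNewtonianSubmodule μ p

namespace TCNewtonianPre

variable {μ : Measure X} {p : ℝ≥0∞} [OpensMeasurableSpace X] [Fact (1 ≤ p)] [Fact (p ≠ ∞)]

instance : AddCommGroup (TCNewtonianPre μ p) :=
  inferInstanceAs (AddCommGroup (tcNewtonianSubmodule μ p))

instance : Module ℝ (TCNewtonianPre μ p) :=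
  inferInstanceAs (Module ℝ (tcNewtonianSubmodule μ p))

/-- The underlying function of an element. -/
def fn (f : TCNewtonianPre μ p) : X → ℝ := Subtype.val f

theorem infLpNorm_lt_top' (f : TCNewtonianPre μ p) :
    infLpNorm μ p (weakUpperSGradients μ p f.fn) < ∞ :=
  infLpNorm_lt_top (Subtype.property f).2.2

/-- The seminorm `‖f‖_{L^p} + inf_g ‖g‖_{L^p}`, over all `p`-weak upper `S`-gradients `g`. -/
instance : Norm (TCNewtonianPre μ p) where
  norm f := (eLpNorm f.fn p μ).toReal + (infLpNorm μ p (weakUpperSGradients μ p f.fn)).toReal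

theorem norm_def (f : TCNewtonianPre μ p) :
    ‖f‖ = (eLpNorm f.fn p μ).toReal + (infLpNorm μ p (weakUpperSGradients μ p f.fn)).toReal := rfl

theorem norm_add_le' (f f' : TCNewtonianPre μ p) : ‖f + f'‖ ≤ ‖f‖ + ‖f'‖ := by
  rw [norm_def, norm_def, norm_def, add_add_add_comm]
  have h1 : eLpNorm f.fn p μ < ∞ := (Subtype.property f).2.1
  have h1' : eLpNorm f'.fn p μ < ∞ := (Subtype.property f').2.1
  have h2 := f.infLpNorm_lt_top'
  have h2' := f'.infLpNorm_lt_top'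
  refine add_le_add ?_ ?_
  · rw [← ENNReal.toReal_add h1.ne h1'.ne]
    exact ENNReal.toReal_mono (ENNReal.add_lt_top.2 ⟨h1, h1'⟩).ne
      (eLpNorm_add_le (Subtype.property f).1.aestronglyMeasurable
        (Subtype.property f').1.aestronglyMeasurable Fact.out)
  · rw [← ENNReal.toReal_add h2.ne h2'.ne]
    exact ENNReal.toReal_mono (ENNReal.add_lt_top.2 ⟨h2, h2'⟩).ne
      (infLpNorm_add_le (fun g hg => Measurable.of_borel hg.1)
        (fun g hg => Measurable.of_borel hg.1) fun g hg g' hg' => IsWeakUpperSGradient.add hg hg')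

theorem norm_smul_le' (r : ℝ) (f : TCNewtonianPre μ p) : ‖r • f‖ ≤ ‖r‖ * ‖f‖ := by
  rw [norm_def, norm_def, mul_add]
  have h2 := f.infLpNorm_lt_top'
  refine add_le_add (le_of_eq ?_) ?_
  · have : (r • f).fn = r • f.fn := rfl
    rw [this, eLpNorm_const_smul, ENNReal.toReal_mul, toReal_enorm]
  · rw [← toReal_enorm r, ← ENNReal.toReal_mul]
    exact ENNReal.toReal_mono (ENNReal.mul_lt_top enorm_lt_top h2).ne
      (infLpNorm_smul_le r (fun g hg => IsWeakUpperSGradient.smul hg r) h2)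

theorem norm_zero' : ‖(0 : TCNewtonianPre μ p)‖ = 0 := by
  refine le_antisymm ?_ (add_nonneg ENNReal.toReal_nonneg ENNReal.toReal_nonneg)
  simpa using norm_smul_le' (0 : ℝ) (0 : TCNewtonianPre μ p)

theorem seminormCore : SeminormedSpace.Core ℝ (TCNewtonianPre μ p) where
  norm_nonneg _ := add_nonneg ENNReal.toReal_nonneg ENNReal.toReal_nonneg
  norm_smul := (Seminorm.ofSMulLE (𝕜 := ℝ) (fun f : TCNewtonianPre μ p => ‖f‖)
    norm_zero' norm_add_le' norm_smul_le').smul'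
  norm_triangle := norm_add_le'

instance : SeminormedAddCommGroup (TCNewtonianPre μ p) :=
  SeminormedAddCommGroup.ofCore seminormCore

instance : NormedSpace ℝ (TCNewtonianPre μ p) where
  norm_smul_le := norm_smul_le'

end TCNewtonianPre

/-- The TC-Newtonian space: the quotient of `TCNewtonianPre μ p` by the relation
`‖f - f'‖ = 0`, with the induced norm. -/
abbrev TCNewtonian (μ : Measure X) (p : ℝ≥0∞) [OpensMeasurableSpace X] [Fact (1 ≤ p)]
    [Fact (p ≠ ∞)] : Type _ := SeparationQuotient (TCNewtonianPre μ p)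

/-- The elements of `L^p(μ)` having a Hajłasz gradient in `L^p(μ)`. -/
def hajlaszSobolevSubmodule (μ : Measure X) (p : ℝ≥0∞) [Fact (1 ≤ p)] :
    Submodule ℝ (Lp ℝ p μ) where
  carrier := {f | ∃ g ∈ hajlaszGradients μ f, eLpNorm g p μ < ∞}
  zero_mem' := ⟨0, IsHajlaszGradient.zero.congr (Lp.coeFn_zero ℝ p μ).symm, by simp⟩
  add_mem' := by
    rintro f f' ⟨g, hg, hgp⟩ ⟨g', hg', hgp'⟩
    exact ⟨g + g', (IsHajlaszGradient.add hg hg').congr (Lp.coeFn_add f f').symm,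
      (eLpNorm_add_le hg.1.aestronglyMeasurable hg'.1.aestronglyMeasurable Fact.out).trans_lt
        (ENNReal.add_lt_top.2 ⟨hgp, hgp'⟩)⟩
  smul_mem' := by
    rintro r f ⟨g, hg, hgp⟩
    exact ⟨_, (IsHajlaszGradient.smul hg r).congr (Lp.coeFn_smul r f).symm,
      (eLpNorm_const_mul_le_ennreal r g).trans_lt (ENNReal.mul_lt_top enorm_lt_top hgp)⟩

/-- The Hajłasz–Sobolev space `M^{1,p}(X)`, whose norm is not the one inherited from `L^p(μ)`. -/
def HajlaszSobolev (μ : Measure X) (p : ℝ≥0∞) [Fact (1 ≤ p)] : Type _ :=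
  hajlaszSobolevSubmodule μ p

namespace HajlaszSobolev

variable {μ : Measure X} {p : ℝ≥0∞} [Fact (1 ≤ p)]

instance : AddCommGroup (HajlaszSobolev μ p) :=
  inferInstanceAs (AddCommGroup (hajlaszSobolevSubmodule μ p))

instance : Module ℝ (HajlaszSobolev μ p) :=
  inferInstanceAs (Module ℝ (hajlaszSobolevSubmodule μ p))

/-- The underlying element of `L^p(μ)`. -/
def toLp (f : HajlaszSobolev μ p) : Lp ℝ p μ := Subtype.val f

theorem infLpNorm_lt_top' (f : HajlaszSobolev μ p) :
    infLpNorm μ p (hajlaszGradients μ f.toLp) < ∞ :=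
  infLpNorm_lt_top (Subtype.property f)

/-- The norm `‖f‖_{L^p} + inf_g ‖g‖_{L^p}`, over all Hajłasz gradients `g` of `f`. -/
instance : Norm (HajlaszSobolev μ p) where
  norm f := ‖f.toLp‖ + (infLpNorm μ p (hajlaszGradients μ f.toLp)).toReal

theorem norm_def (f : HajlaszSobolev μ p) :
    ‖f‖ = ‖f.toLp‖ + (infLpNorm μ p (hajlaszGradients μ f.toLp)).toReal := rfl

theorem norm_add_le' (f f' : HajlaszSobolev μ p) : ‖f + f'‖ ≤ ‖f‖ + ‖f'‖ := by
  rw [norm_def, norm_def, norm_def, add_add_add_comm]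
  have h2 := f.infLpNorm_lt_top'
  have h2' := f'.infLpNorm_lt_top'
  refine add_le_add (norm_add_le f.toLp f'.toLp) ?_
  rw [← ENNReal.toReal_add h2.ne h2'.ne]
  exact ENNReal.toReal_mono (ENNReal.add_lt_top.2 ⟨h2, h2'⟩).ne
    (infLpNorm_add_le (fun g hg => hg.1) (fun g hg => hg.1) fun g hg g' hg' =>
      (IsHajlaszGradient.add hg hg').congr (Lp.coeFn_add f.toLp f'.toLp).symm)

theorem norm_smul_le' (r : ℝ) (f : HajlaszSobolev μ p) : ‖r • f‖ ≤ ‖r‖ * ‖f‖ := by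
  rw [norm_def, norm_def, mul_add]
  have h2 := f.infLpNorm_lt_top'
  refine add_le_add (norm_smul_le r f.toLp) ?_
  rw [← toReal_enorm r, ← ENNReal.toReal_mul]
  exact ENNReal.toReal_mono (ENNReal.mul_lt_top enorm_lt_top h2).ne
    (infLpNorm_smul_le r (fun g hg =>
      (IsHajlaszGradient.smul hg r).congr (Lp.coeFn_smul r f.toLp).symm) h2)

theorem norm_zero' : ‖(0 : HajlaszSobolev μ p)‖ = 0 := by
  refine le_antisymm ?_ (add_nonneg (norm_nonneg _) ENNReal.toReal_nonneg)
  simpa using norm_smul_le' (0 : ℝ) (0 : HajlaszSobolev μ p)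

theorem normedCore : NormedSpace.Core ℝ (HajlaszSobolev μ p) where
  norm_nonneg _ := add_nonneg (norm_nonneg _) ENNReal.toReal_nonneg
  norm_smul := (Seminorm.ofSMulLE (𝕜 := ℝ) (fun f : HajlaszSobolev μ p => ‖f‖)
    norm_zero' norm_add_le' norm_smul_le').smul'
  norm_triangle := norm_add_le'
  norm_eq_zero_iff f := by
    refine ⟨fun h => ?_, fun h => by rw [h, norm_zero']⟩
    have h1 : ‖f.toLp‖ = 0 :=
      le_antisymm ((le_add_of_nonneg_right ENNReal.toReal_nonneg).trans h.le) (norm_nonneg _)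
    exact Subtype.ext (norm_eq_zero.1 h1)

instance : NormedAddCommGroup (HajlaszSobolev μ p) := NormedAddCommGroup.ofCore normedCore

instance : NormedSpace ℝ (HajlaszSobolev μ p) := NormedSpace.ofCore normedCore

end HajlaszSobolev

end

/-! From curves to points. A family of curves has modulus zero exactly when some `ρ` in `L^p` has
infinite symmetrized integral over each of its members
(`exists_symmIntegral_eq_top_of_modulus_eq_zero` and its converse). The curve that sits at `x` and
jumps to `y` has integral at most `(g x + g y) * edist x y`, so it cannot be exceptional when `ρ` is
finite at `x` and `y`. Hence every `p`-weak upper `S`-gradient is already a Hajłasz gradient, and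
the map does not increase norms.

From points to curves. By Borel regularity and σ-finiteness, a Hajłasz gradient may be taken Borel
with its inequality valid everywhere. For a Lipschitz `h`, the interval between two values of `h ∘
γ` is covered by the range of `h ∘ γ` and the intervals spanned by its jumps. The range is measured
by splitting `γ` into dyadic levels of the gradient and factoring through arc length. A jump at `u`
costs the gradient at both `γ(u⁻)` and `γ(u)`; the first value is charged by the reversed curve, the
second by `γ`, and this is why the integral is symmetrized (`edist_comp_le_symmIntegral`). A general
`f` is Lipschitz only on each set `{g ≤ k}`. Its Lipschitz extensions from these sets converge along
every nontrivial curve of finite `g`-integral, because their differences have gradients supported in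
`{g > k}`. The limit is a representative with upper gradient `20 g` (`exists_borel_representative`).

It remains to see that the representative does not matter. If `u` is in the Newtonian class and
vanishes a.e., almost every curve spends no variation in a Borel null set containing `{u ≠ 0}`.
Freezing the curve at times just after it first leaves that set forces `u` to vanish at its starting
point, and reversal treats the other endpoint. So `0` is a weak gradient of `u`
(`zero_of_ae_eq_zero`), gradients transfer between a.e. equal members of the class, and the inverse
has norm at most `20`. -/

noncomputable section

/-! ### Variation measures, jumps and reversal. -/

namespace TestCurve

variable {X : Type*} [MetricSpace X]

theorem ofReal_variationFunction_sub (γ : TestCurve X) {r s : I} (h : r ≤ s) :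
    ENNReal.ofReal (γ.variationFunction s - γ.variationFunction r) =
      eVariationOn γ (Icc r s) := by
  have hb : ∀ a b : I, eVariationOn γ (Icc a b) ≠ ∞ := fun a b =>
    γ.boundedVariation.mono (subset_univ _)
  have key := eVariationOn.Icc_add_Icc γ.toFun (s := univ) (unitInterval.nonneg' (t := r)) h
    (mem_univ r)
  simp only [univ_inter] at key
  have : γ.variationFunction s - γ.variationFunction r =
      (eVariationOn γ (Icc r s)).toReal := by
    change (eVariationOn γ (Icc 0 s)).toReal - (eVariationOn γ (Icc 0 r)).toReal = _
    rw [← key, ENNReal.toReal_add (hb _ _) (hb _ _)]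
    ring
  rw [this, ENNReal.ofReal_toReal (hb _ _)]

theorem variationMeasure_Ioc (γ : TestCurve X) {r s : I} (h : r ≤ s) :
    γ.variationMeasure (Ioc r s) = eVariationOn γ (Icc r s) := by
  rw [variationMeasure, StieltjesFunction.measure_Ioc, γ.ofReal_variationFunction_sub h]

theorem botSet_unitInterval : (botSet : Set I) = {0} :=
  botSet_eq_singleton_of_isBot fun _ => unitInterval.nonneg'

theorem variationMeasure_singleton_zero (γ : TestCurve X) : γ.variationMeasure {0} = 0 := by
  rw [← botSet_unitInterval, variationMeasure, StieltjesFunction.measure_botSet]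

theorem variationMeasure_Iic (γ : TestCurve X) (t : I) :
    γ.variationMeasure (Iic t) = eVariationOn γ (Icc 0 t) := by
  have h : Iic t = {0} ∪ Ioc 0 t := by
    ext s
    simp only [mem_Iic, mem_union, mem_singleton_iff, mem_Ioc]
    constructor
    · intro hs
      rcases (unitInterval.nonneg' (t := s)).eq_or_lt with h | h
      · exact Or.inl h.symm
      · exact Or.inr ⟨h, hs⟩
    · rintro (rfl | h)
      · exact unitInterval.nonneg'
      · exact h.2
  rw [h, measure_union (by simp) measurableSet_Ioc, γ.variationMeasure_singleton_zero, zero_add,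
    γ.variationMeasure_Ioc unitInterval.nonneg']

theorem variationMeasure_univ (γ : TestCurve X) :
    γ.variationMeasure univ = eVariationOn γ univ := by
  have h : (univ : Set I) = Iic 1 := by ext s; simp [unitInterval.le_one']
  have h' : (univ : Set I) = Icc 0 1 := by
    ext s; simp [unitInterval.le_one']
  rw [h, γ.variationMeasure_Iic, ← h', h]

instance (γ : TestCurve X) : IsFiniteMeasure γ.variationMeasure :=
  ⟨by rw [γ.variationMeasure_univ]; exact γ.boundedVariation.lt_top⟩

/-- The variation measure dominates every outer measure that is dominated by the variation on
half-open intervals and does not charge `0`. -/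
theorem outerMeasure_le_variationMeasure (γ : TestCurve X) (ν : OuterMeasure I) (h0 : ν {0} = 0)
    (h : ∀ r s : I, r ≤ s → ν (Ioc r s) ≤ eVariationOn γ (Icc r s)) (A : Set I) :
    ν A ≤ γ.variationMeasure A := by
  rw [variationMeasure, StieltjesFunction.measure]
  -- The Stieltjes outer measure is the largest one below its length function, so only sets inside
  -- half-open intervals need testing. That length ignores the point `0`, whence the hypothesis
  -- `h0`.
  refine (show ν ≤ γ.variationFunction.outer from OuterMeasure.le_ofFunction.2 fun s => ?_) A
  rw [StieltjesFunction.length_eq]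
  refine le_iInf fun a => le_iInf fun b => le_iInf fun hs => ?_
  rw [botSet_unitInterval] at hs
  have hsub : s ⊆ {0} ∪ Ioc a b := fun x hx => by
    by_cases hx0 : x = 0
    · exact Or.inl hx0
    · exact Or.inr (hs ⟨hx, hx0⟩)
  refine (measure_mono hsub).trans ((measure_union_le _ _).trans ?_)
  rw [h0, zero_add]
  rcases le_total a b with hab | hab
  · rw [γ.ofReal_variationFunction_sub hab]
    exact h a b hab
  · rw [Ioc_eq_empty (not_lt.2 hab)]
    simp

theorem variationMeasure_mono {Y : Type*} [MetricSpace Y] (α : TestCurve X) (β : TestCurve Y)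
    (h : ∀ r s : I, r ≤ s → eVariationOn α (Icc r s) ≤ eVariationOn β (Icc r s)) :
    α.variationMeasure ≤ β.variationMeasure := by
  refine Measure.le_iff'.2 fun s => ?_
  refine β.outerMeasure_le_variationMeasure α.variationMeasure.toOuterMeasure
    α.variationMeasure_singleton_zero (fun r s hrs => ?_) s
  exact (α.variationMeasure_Ioc hrs).le.trans (h r s hrs)

/-- The atom at `t` is the jump of the variation function there; let `r` increase to `t` in `d(γ r,
γ t) ≤ V(t) - V(r)`. -/
theorem edist_leftLim_le_variationMeasure (γ : TestCurve X) (t : I) :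
    edist (Function.leftLim γ t) (γ t) ≤ γ.variationMeasure {t} := by
  rcases eq_or_neBot (𝓝[<] t) with h | h
  · rw [leftLim_eq_of_eq_bot _ h]
    simp
  rw [variationMeasure, StieltjesFunction.measure_singleton]
  have h1 : Tendsto (fun r => edist (γ r) (γ t)) (𝓝[<] t)
      (𝓝 (edist (Function.leftLim γ t) (γ t))) := (γ.tendsto_leftLim t).edist tendsto_const_nhds
  have h2 : Tendsto (fun r => ENNReal.ofReal (γ.variationFunction t - γ.variationFunction r))
      (𝓝[<] t) (𝓝 (ENNReal.ofReal
        (γ.variationFunction t - Function.leftLim γ.variationFunction t))) :=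
    ENNReal.tendsto_ofReal
      (tendsto_const_nhds.sub (γ.variationFunction.mono.tendsto_leftLim t))
  refine le_of_tendsto_of_tendsto h1 h2 ?_
  filter_upwards [self_mem_nhdsWithin] with r hr
  rw [γ.ofReal_variationFunction_sub (le_of_lt hr)]
  exact eVariationOn.edist_le _ (left_mem_Icc.2 (le_of_lt hr)) (right_mem_Icc.2 (le_of_lt hr))

theorem leftLim_one (γ : TestCurve X) : Function.leftLim γ 1 = γ 1 :=
  γ.leftContinuous_one.leftLim_eq

theorem leftLim_zero (γ : TestCurve X) : Function.leftLim γ 0 = γ 0 :=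
  leftLim_eq_of_isBot fun _ => unitInterval.nonneg'

theorem reverse_apply (γ : TestCurve X) (t : I) :
    γ.reverse t = Function.leftLim γ (unitInterval.symm t) := rfl

/-- Reversal exchanges the two one-sided values of a curve. The case `t = 0` needs left continuity
of `γ` at `1`. -/
theorem leftLim_reverse (γ : TestCurve X) (t : I) :
    Function.leftLim γ.reverse t = γ (unitInterval.symm t) := by
  rcases (unitInterval.nonneg' (t := t)).eq_or_lt with h | h
  · rw [← h, leftLim_zero, reverse_apply, unitInterval.symm_zero, leftLim_one]
  · have : (𝓝[<] t).NeBot := nhdsLT_neBot_of_exists_lt ⟨0, h⟩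
    exact leftLim_eq_of_tendsto (γ.tendsto_reverse_left t h)

theorem toFun_injective : Function.Injective (toFun : TestCurve X → I → X) := by
  rintro ⟨a, _, _, _, _⟩ ⟨b, _, _, _, _⟩ (rfl : a = b)
  rfl

@[simp] theorem reverse_reverse (γ : TestCurve X) : γ.reverse.reverse = γ := by
  apply toFun_injective
  funext t
  rw [reverse_apply, leftLim_reverse, unitInterval.symm_symm]

theorem symmIntegral_reverse (γ : TestCurve X) (g : X → ℝ≥0∞) :
    γ.reverse.symmIntegral g = γ.symmIntegral g := by
  rw [symmIntegral, symmIntegral, reverse_reverse, add_comm]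

theorem eVariationOn_reverse_le (γ : TestCurve X) :
    eVariationOn γ.reverse univ ≤ eVariationOn γ univ :=
  (eVariationOn.comp_le_of_antitoneOn (Function.leftLim γ.toFun) (s := univ)
      (t := univ) unitInterval.symm (fun a _ b _ hab => by simpa using hab)
      (fun _ _ => mem_univ _)).trans (eVariationOn.eVariationOn_leftLim_le isOpen_univ)

theorem IsNontrivial.reverse {γ : TestCurve X} (h : γ.IsNontrivial) : γ.reverse.IsNontrivial := by
  refine lt_of_lt_of_le h ?_
  conv_lhs => rw [← γ.reverse_reverse]
  exact γ.reverse.eVariationOn_reverse_le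

theorem edist_leftLim_le_variationMeasure_reverse (γ : TestCurve X) (t : I) :
    edist (Function.leftLim γ t) (γ t) ≤ γ.reverse.variationMeasure {unitInterval.symm t} := by
  refine le_trans (le_of_eq ?_)
    (γ.reverse.edist_leftLim_le_variationMeasure (unitInterval.symm t))
  rw [leftLim_reverse, reverse_apply, unitInterval.symm_symm, edist_comm]

theorem integral_add_integral_reverse (γ : TestCurve X) (g : X → ℝ≥0∞) :
    γ.integral g + γ.reverse.integral g = 2 * γ.symmIntegral g := by
  rw [symmIntegral, ENNReal.mul_div_cancel (by simp) (by simp)]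

/-- By right continuity, `γ` is the pointwise limit of step maps that round `t` up to the grid of
mesh `1 / (n + 1)`. -/
theorem measurable_borel (γ : TestCurve X) : Measurable[_, borel X] γ := by
  let _ : MeasurableSpace X := borel X
  have : BorelSpace X := ⟨rfl⟩
  let F : ℕ → ℕ → I := fun n k => projIcc 0 1 zero_le_one ((k : ℝ) / (n + 1 : ℝ))
  have hc : ∀ t : I, Tendsto (fun n : ℕ => F n ⌈(t : ℝ) * (n + 1)⌉₊) atTop (𝓝[≥] t) := by
    intro t
    refine tendsto_nhdsWithin_iff.2 ⟨?_, Eventually.of_forall fun n => ?_⟩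
    · have h1 : Tendsto (fun n : ℕ => (⌈(t : ℝ) * (n + 1)⌉₊ : ℝ) / (n + 1 : ℝ)) atTop
          (𝓝 (t : ℝ)) :=
        (tendsto_nat_ceil_mul_div_atTop t.2.1).comp
          (tendsto_natCast_atTop_atTop.atTop_add tendsto_const_nhds)
      have h2 := ((continuous_projIcc (h := zero_le_one (α := ℝ))).tendsto (t : ℝ)).comp h1
      rwa [projIcc_val] at h2
    · have h0 : (0 : ℝ) < n + 1 := by positivity
      have h1 : (t : ℝ) ≤ (⌈(t : ℝ) * (n + 1)⌉₊ : ℝ) / (n + 1 : ℝ) := by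
        rw [le_div_iff₀ h0]
        exact Nat.le_ceil _
      have h2 := monotone_projIcc (zero_le_one (α := ℝ)) h1
      rwa [projIcc_val] at h2
  refine measurable_of_tendsto_metrizable (f := fun n (t : I) => γ (F n ⌈(t : ℝ) * (n + 1)⌉₊))
    (fun n => ?_) (tendsto_pi_nhds.2 fun t => (γ.continuousWithinAt_Ici t).tendsto.comp (hc t))
  have : Measurable fun k : ℕ => γ (F n k) := measurable_from_top
  exact this.comp (Nat.measurable_ceil.comp (measurable_subtype_coe.mul_const _))

end TestCurve

/-! ### Intermediate values of right-continuous functions with left limits. -/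

/-- Take `u` to be the supremum of the times in `[s, t]` with `φ ≤ v`. If it is attained, right
continuity gives `φ u = v`. Otherwise `φ u > v`, while times approaching `u` from the left give `ψ u
≤ v`, so `v` is skipped by the jump at `u`. -/
theorem exists_mem_Icc_leftLim_or_eq {φ ψ : I → ℝ} (hr : ∀ u, ContinuousWithinAt φ (Ici u) u)
    (hl : ∀ u, Tendsto φ (𝓝[<] u) (𝓝 (ψ u))) {s t : I} (hst : s ≤ t) {v : ℝ} (hs : φ s ≤ v)
    (ht : v ≤ φ t) : ∃ u, v ∈ Icc (ψ u) (φ u) ∨ v = φ u := by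
  set S : Set I := {w | w ∈ Icc s t ∧ φ w ≤ v} with hS
  have hsS : s ∈ S := ⟨⟨le_rfl, hst⟩, hs⟩
  have hlub : IsLUB S (sSup S) := isLUB_sSup S
  set u := sSup S with hu
  have hsu : s ≤ u := hlub.1 hsS
  have hut : u ≤ t := hlub.2 fun w hw => hw.1.2
  refine ⟨u, ?_⟩
  by_cases huS : u ∈ S
  · right
    rcases hut.eq_or_lt with h | h
    · rw [h] at huS ⊢
      exact le_antisymm ht huS.2
    · have hne : (𝓝[>] u).NeBot := nhdsGT_neBot_of_exists_gt ⟨t, h⟩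
      refine le_antisymm ?_ huS.2
      have h1 : Tendsto φ (𝓝[>] u) (𝓝 (φ u)) :=
        (hr u).tendsto.mono_left (nhdsWithin_mono _ Ioi_subset_Ici_self)
      refine ge_of_tendsto h1 ?_
      filter_upwards [Ioc_mem_nhdsGT h] with w hw
      by_contra hlt
      exact (hlub.1 ⟨⟨hsu.trans hw.1.le, hw.2⟩, (not_le.1 hlt).le⟩).not_gt hw.1
  · left
    have hsu' : s < u := hsu.lt_of_ne fun h => huS (h ▸ hsS)
    refine ⟨?_, ?_⟩
    · by_contra hlt
      have h1 := (hl u).eventually_const_lt (not_le.1 hlt)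
      obtain ⟨a, ha, hau⟩ := (mem_nhdsLT_iff_exists_Ioo_subset' hsu').1 h1
      obtain ⟨w, hw, haw⟩ := (lt_isLUB_iff hlub).1 ha
      have hwu : w < u := (hlub.1 hw).lt_of_ne fun h => huS (h ▸ hw)
      exact (hau ⟨haw, hwu⟩ : v < φ w).not_ge hw.2
    · by_contra hlt
      exact huS ⟨⟨hsu, hut⟩, (not_le.1 hlt).le⟩

theorem exists_mem_uIcc_leftLim_or_eq {φ ψ : I → ℝ} (hr : ∀ u, ContinuousWithinAt φ (Ici u) u)
    (hl : ∀ u, Tendsto φ (𝓝[<] u) (𝓝 (ψ u))) {s t : I} {v : ℝ} (hv : v ∈ uIcc (φ s) (φ t)) :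
    ∃ u, v ∈ uIcc (ψ u) (φ u) ∨ v = φ u := by
  wlog hst : s ≤ t generalizing s t
  · exact this (by rwa [uIcc_comm]) (le_of_not_ge hst)
  rcases mem_uIcc.1 hv with h | h
  · obtain ⟨u, hu⟩ := exists_mem_Icc_leftLim_or_eq hr hl hst h.1 h.2
    exact ⟨u, hu.imp_left fun h => Icc_subset_uIcc h⟩
  · obtain ⟨u, hu⟩ := exists_mem_Icc_leftLim_or_eq (φ := fun u => -φ u) (ψ := fun u => -ψ u)
      (fun u => (hr u).neg) (fun u => (hl u).neg) hst (v := -v) (neg_le_neg h.2) (neg_le_neg h.1)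
    refine ⟨u, hu.imp (fun h => ?_) neg_injective.eq_iff.1⟩
    exact Icc_subset_uIcc' ⟨neg_le_neg_iff.1 h.2, neg_le_neg_iff.1 h.1⟩

/-! ### Oscillation of Lipschitz functions along a test curve. -/

namespace TestCurve

variable {X : Type*} [MetricSpace X]

/-- The set function `A ↦ |V(A)|` is an outer measure, and it sends `(r, s]` into `[V(r), V(s)]`;
maximality of the variation measure does the rest. Working with outer measures avoids measurability
of images. -/
theorem volume_variationFunction_image_le (γ : TestCurve X) (A : Set I) :
    volume (γ.variationFunction '' A) ≤ γ.variationMeasure A := by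
  refine γ.outerMeasure_le_variationMeasure
    (OuterMeasure.comap γ.variationFunction (volume : Measure ℝ).toOuterMeasure) ?_ ?_ A
  · simp
  · intro r s hrs
    rw [OuterMeasure.comap_apply, ← γ.ofReal_variationFunction_sub hrs, ← Real.volume_Icc]
    refine measure_mono (image_subset_iff.2 fun u hu => ?_)
    exact ⟨γ.variationFunction.mono hu.1.le, γ.variationFunction.mono hu.2⟩

theorem edist_le_edist_variationFunction (γ : TestCurve X) (u v : I) :
    edist (γ u) (γ v) ≤ edist (γ.variationFunction u) (γ.variationFunction v) := by
  wlog h : u ≤ v generalizing u v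
  · rw [edist_comm, edist_comm (γ.variationFunction u)]
    exact this v u (le_of_not_ge h)
  rw [edist_comm (γ.variationFunction u), edist_dist (γ.variationFunction v), Real.dist_eq,
    abs_of_nonneg (sub_nonneg.2 (γ.variationFunction.mono h)), γ.ofReal_variationFunction_sub h]
  exact eVariationOn.edist_le _ (left_mem_Icc.2 h) (right_mem_Icc.2 h)

/-- On `A` the function `φ` factors through arc length as `F ∘ V`, because equal values of `V` force
equal points of `γ` and then equal values of `φ`. The factor `F` is `K`-Lipschitz, so it multiplies
length by at most `K`. -/
theorem volume_image_le_of_edist_le (γ : TestCurve X) {φ : I → ℝ} {A : Set I} {K : ℝ≥0∞}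
    (hK : K ≠ ∞) (h : ∀ u ∈ A, ∀ v ∈ A, edist (φ u) (φ v) ≤ K * edist (γ u) (γ v)) :
    volume (φ '' A) ≤ K * γ.variationMeasure A := by
  lift K to NNReal using hK
  let V := γ.variationFunction
  let F : ℝ → ℝ := φ ∘ Function.invFunOn V A
  have hmem : ∀ x ∈ V '' A, Function.invFunOn V A x ∈ A ∧ V (Function.invFunOn V A x) = x :=
    fun x hx => Function.invFunOn_pos hx
  have hF : LipschitzOnWith K F (V '' A) := fun x hx y hy => by
    refine (h _ (hmem x hx).1 _ (hmem y hy).1).trans ?_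
    gcongr
    refine (γ.edist_le_edist_variationFunction _ _).trans (le_of_eq ?_)
    change edist (V _) (V _) = _
    rw [(hmem x hx).2, (hmem y hy).2]
  have hsub : φ '' A ⊆ F '' (V '' A) := by
    rintro _ ⟨u, hu, rfl⟩
    have hVu : V u ∈ V '' A := mem_image_of_mem _ hu
    refine ⟨V u, hVu, ?_⟩
    have h1 := h _ (hmem _ hVu).1 u hu
    have h2 := γ.edist_le_edist_variationFunction (Function.invFunOn V A (V u)) u
    change _ ≤ edist (V _) (V _) at h2
    rw [(hmem _ hVu).2, edist_self] at h2
    rw [nonpos_iff_eq_zero.1 h2, mul_zero] at h1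
    exact edist_le_zero.1 h1
  calc volume (φ '' A) ≤ volume (F '' (V '' A)) := measure_mono hsub
    _ ≤ K * volume (V '' A) := by
        have := hF.hausdorffMeasure_image_le zero_le_one
        simpa [hausdorffMeasure_real] using this
    _ ≤ K * γ.variationMeasure A := by
        gcongr
        exact γ.volume_variationFunction_image_le A

/-- On the level `2 ^ n ≤ G ∘ γ < 2 ^ (n + 1)` the hypothesis gives a Lipschitz bound with constant
`4 * 2 ^ n`, which is at most four times the value of `G` there. Summing over `n` yields the
integral. -/
theorem volume_range_comp_le (γ : TestCurve X) {h : X → ℝ} {K : NNReal} (hh : LipschitzWith K h)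
    {G : X → ℝ≥0∞} (hG : Measurable[borel X] G)
    (H : ∀ x y, edist (h x) (h y) ≤ (G x + G y) * edist x y) :
    volume (range (h ∘ γ)) ≤ 4 * γ.integral G := by
  by_cases hfin : γ.integral G = ∞
  · rw [hfin]; simp
  have hq : Measurable (G ∘ γ) := hG.comp γ.measurable_borel
  set q : I → ℝ≥0∞ := G ∘ γ with hqdef
  have htop : γ.variationMeasure (q ⁻¹' {∞}) = 0 := by
    have := ae_lt_top hq hfin
    rw [ae_iff] at this
    convert this using 2
    ext u; simp
  let A : ℤ → Set I := fun n => q ⁻¹' Ico (2 ^ n) (2 ^ (n + 1))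
  have hAm : ∀ n, MeasurableSet (A n) := fun n => hq measurableSet_Ico
  have hcover : range (h ∘ γ) ⊆ (h ∘ γ) '' (q ⁻¹' {0}) ∪ (h ∘ γ) '' (q ⁻¹' {∞}) ∪
      ⋃ n, (h ∘ γ) '' (A n) := by
    rintro _ ⟨u, rfl⟩
    by_cases h0 : q u = 0
    · exact Or.inl (Or.inl ⟨u, h0, rfl⟩)
    by_cases h1 : q u = ∞
    · exact Or.inl (Or.inr ⟨u, h1, rfl⟩)
    obtain ⟨n, hn⟩ := ENNReal.exists_mem_Ico_zpow h0 h1 ENNReal.one_lt_two ENNReal.ofNat_ne_top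
    exact Or.inr (mem_iUnion.2 ⟨n, u, hn, rfl⟩)
  have hz : volume ((h ∘ γ) '' (q ⁻¹' {0})) = 0 := by
    refine nonpos_iff_eq_zero.1 ((γ.volume_image_le_of_edist_le (K := 0) (by simp)
      fun u hu v hv => ?_).trans (by simp))
    refine (H _ _).trans (le_of_eq ?_)
    rw [show G (γ u) = 0 from hu, show G (γ v) = 0 from hv, add_zero]
  -- Where `G` is infinite the gradient says nothing; the Lipschitz bound on `h` is what makes the
  -- image of this null set of times null.
  have hi : volume ((h ∘ γ) '' (q ⁻¹' {∞})) = 0 := by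
    refine nonpos_iff_eq_zero.1 ((γ.volume_image_le_of_edist_le (K := K) (by simp)
      fun u hu v hv => hh _ _).trans ?_)
    rw [htop, mul_zero]
  have htwo : ∀ n : ℤ, (2 : ℝ≥0∞) ^ (n + 1) = 2 ^ n * 2 := fun n => by
    rw [ENNReal.zpow_add (by simp) (by simp), zpow_one]
  have hn : ∀ n, volume ((h ∘ γ) '' (A n)) ≤ 4 * γ.variationMeasure.withDensity q (A n) := by
    intro n
    have hfinn : (2 : ℝ≥0∞) ^ n ≠ ∞ := by
      exact ENNReal.zpow_ne_top (by simp) (by simp) n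
    refine (γ.volume_image_le_of_edist_le (K := 4 * 2 ^ n)
      (ENNReal.mul_ne_top (by simp) hfinn) fun u hu v hv => ?_).trans ?_
    · refine (H _ _).trans ?_
      gcongr
      refine (add_le_add hu.2.le hv.2.le).trans (le_of_eq ?_)
      rw [htwo]; ring
    · rw [mul_assoc]
      gcongr
      rw [withDensity_apply _ (hAm n), ← setLIntegral_const]
      exact setLIntegral_mono hq fun u hu => hu.1
  have hmono : Monotone fun n : ℤ => (2 : ℝ≥0∞) ^ n := ENNReal.monotone_zpow ENNReal.one_lt_two.le
  have hdisj : Pairwise (Function.onFun Disjoint A) := fun m n hmn =>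
    (hmono.pairwise_disjoint_on_Ico_succ hmn).preimage q
  calc volume (range (h ∘ γ)) ≤ volume ((h ∘ γ) '' (q ⁻¹' {0}) ∪ (h ∘ γ) '' (q ⁻¹' {∞})) +
        volume (⋃ n, (h ∘ γ) '' (A n)) := (measure_mono hcover).trans (measure_union_le _ _)
    _ ≤ ∑' n, volume ((h ∘ γ) '' (A n)) := by
        rw [measure_union_null hz hi, zero_add]
        exact measure_iUnion_le _
    _ ≤ ∑' n, 4 * γ.variationMeasure.withDensity q (A n) := ENNReal.tsum_le_tsum hn
    _ ≤ 4 * γ.integral G := by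
        rw [ENNReal.tsum_mul_left]
        gcongr
        refine (tsum_meas_le_meas_iUnion_of_disjoint _ hAm hdisj).trans ?_
        refine (measure_mono (subset_univ _)).trans (le_of_eq ?_)
        rw [withDensity_apply _ MeasurableSet.univ, setLIntegral_univ]
        rfl

theorem countable_leftLim_ne (γ : TestCurve X) : {u | Function.leftLim γ u ≠ γ u}.Countable := by
  have h := Measure.countable_meas_level_set_pos (μ := γ.variationMeasure) (measurable_id (α := I))
  refine h.mono fun u hu => ?_
  exact (edist_pos.2 hu).trans_le (γ.edist_leftLim_le_variationMeasure u)

theorem tsum_mul_edist_leftLim_le (γ : TestCurve X) (G : X → ℝ≥0∞) :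
    ∑' u : {u | Function.leftLim γ u ≠ γ u}, G (γ u) * edist (Function.leftLim γ u) (γ u) ≤
      γ.integral G := by
  refine le_trans (ENNReal.tsum_le_tsum fun u => ?_)
    ((lintegral_countable (μ := γ.variationMeasure) (fun u => G (γ u))
      γ.countable_leftLim_ne).symm.le.trans (setLIntegral_le_lintegral _ _))
  gcongr
  exact γ.edist_leftLim_le_variationMeasure _

/-- The left-limit values at the jumps of `γ` are the values taken by the reversed curve at its own
jumps. -/
theorem tsum_leftLim_mul_edist_leftLim_le (γ : TestCurve X) (G : X → ℝ≥0∞) :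
    ∑' u : {u | Function.leftLim γ u ≠ γ u},
      G (Function.leftLim γ u) * edist (Function.leftLim γ u) (γ u) ≤ γ.reverse.integral G := by
  refine le_trans (le_of_eq ?_) (γ.reverse.tsum_mul_edist_leftLim_le G)
  let e : {u | Function.leftLim γ u ≠ γ u} ≃
      {u | Function.leftLim γ.reverse u ≠ γ.reverse u} :=
    { toFun := fun u => ⟨unitInterval.symm u, by
        have := u.2
        simp only [mem_ofPred_eq] at this ⊢
        rw [leftLim_reverse, reverse_apply, unitInterval.symm_symm]
        exact this.symm⟩
      invFun := fun u => ⟨unitInterval.symm u, by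
        have := u.2
        simp only [mem_ofPred_eq] at this ⊢
        rw [leftLim_reverse, reverse_apply] at this
        exact this.symm⟩
      left_inv := fun u => Subtype.ext (unitInterval.symm_symm _)
      right_inv := fun u => Subtype.ext (unitInterval.symm_symm _) }
  rw [← e.tsum_eq]
  refine tsum_congr fun u => ?_
  change _ = G (γ.reverse (unitInterval.symm u)) * edist (Function.leftLim γ.reverse
    (unitInterval.symm u)) (γ.reverse (unitInterval.symm u))
  rw [leftLim_reverse, reverse_apply, unitInterval.symm_symm, edist_comm]

/-- A pointwise Hajłasz gradient of a Lipschitz function is, up to a constant, an upper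
`S`-gradient along every test curve. -/
theorem edist_comp_le_symmIntegral (γ : TestCurve X) {h : X → ℝ} {K : NNReal}
    (hh : LipschitzWith K h) {G : X → ℝ≥0∞} (hG : Measurable[borel X] G)
    (H : ∀ x y, edist (h x) (h y) ≤ (G x + G y) * edist x y) (s t : I) :
    edist (h (γ s)) (h (γ t)) ≤ 10 * γ.symmIntegral G := by
  let D : Set I := {u | Function.leftLim γ u ≠ γ u}
  have : Countable D := γ.countable_leftLim_ne.to_subtype
  have hcover : uIcc (h (γ s)) (h (γ t)) ⊆
      range (h ∘ γ) ∪ ⋃ u : D, uIcc (h (Function.leftLim γ u)) (h (γ u)) := by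
    intro v hv
    obtain ⟨u, hu⟩ := exists_mem_uIcc_leftLim_or_eq (φ := fun u => h (γ u))
      (ψ := fun u => h (Function.leftLim γ u))
      (fun u => hh.continuous.continuousAt.comp_continuousWithinAt (γ.continuousWithinAt_Ici u))
      (fun u => (hh.continuous.tendsto _).comp (γ.tendsto_leftLim u)) hv
    by_cases huD : u ∈ D
    · rcases hu with hu | rfl
      · exact Or.inr (mem_iUnion.2 ⟨⟨u, huD⟩, hu⟩)
      · exact Or.inl ⟨u, rfl⟩
    · have hlu : Function.leftLim γ u = γ u := not_not.1 huD
      rw [hlu, uIcc_self, mem_singleton_iff, or_self] at hu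
      exact Or.inl ⟨u, hu.symm⟩
  have hvol : ∀ a b : ℝ, volume (uIcc a b) = edist a b := fun a b => by
    rw [Real.volume_interval, edist_comm, edist_dist, Real.dist_eq]
  calc edist (h (γ s)) (h (γ t)) = volume (uIcc (h (γ s)) (h (γ t))) := (hvol _ _).symm
    _ ≤ volume (range (h ∘ γ)) +
        ∑' u : D, volume (uIcc (h (Function.leftLim γ u)) (h (γ u))) :=
        (measure_mono hcover).trans ((measure_union_le _ _).trans
          (add_le_add le_rfl (measure_iUnion_le _)))
    -- The range contributes the factor `4`; the jumps contribute one further copy of each one-sided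
    -- integral.
    _ ≤ 4 * γ.integral G + (γ.reverse.integral G + γ.integral G) := by
        refine add_le_add (γ.volume_range_comp_le hh hG H) ?_
        refine le_trans (ENNReal.tsum_le_tsum fun u => ?_) (ENNReal.tsum_add.le.trans (add_le_add
          (γ.tsum_leftLim_mul_edist_leftLim_le G) (γ.tsum_mul_edist_leftLim_le G)))
        rw [hvol, ← add_mul]
        exact H _ _
    _ ≤ 5 * (γ.integral G + γ.reverse.integral G) := by
        have : 5 * (γ.integral G + γ.reverse.integral G) = 4 * γ.integral G +
          (γ.reverse.integral G + γ.integral G) + 4 * γ.reverse.integral G := by ring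
        rw [this]
        exact le_self_add
    _ = 10 * γ.symmIntegral G := by
        rw [integral_add_integral_reverse]; ring

end TestCurve

/-! ### Truncation: from a pointwise Hajłasz gradient to a representative that is good on curves. -/

/-- The function equal to `8 g` where `g > k`, and to `0` elsewhere. -/
def scaledTail {X : Type*} (g : X → ℝ≥0∞) (k : ℕ) : X → ℝ≥0∞ :=
  {x | (k : ℝ≥0∞) < g x}.indicator fun x => 8 * g x

theorem scaledTail_of_lt {X : Type*} {g : X → ℝ≥0∞} {k : ℕ} {x : X} (h : (k : ℝ≥0∞) < g x) :
    scaledTail g k x = 8 * g x :=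
  indicator_of_mem (s := {x | (k : ℝ≥0∞) < g x}) h _

theorem scaledTail_of_le {X : Type*} {g : X → ℝ≥0∞} {k : ℕ} {x : X} (h : g x ≤ k) :
    scaledTail g k x = 0 :=
  indicator_of_notMem (s := {x | (k : ℝ≥0∞) < g x}) (not_lt.2 h) _

theorem measurable_scaledTail {X : Type*} {_ : MeasurableSpace X} {g : X → ℝ≥0∞}
    (hg : Measurable g) (k : ℕ) : Measurable (scaledTail g k) :=
  (hg.const_mul 8).indicator (measurableSet_lt measurable_const hg)

namespace TestCurve

variable {X : Type*} [MetricSpace X]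

theorem integral_le_two_mul_symmIntegral (γ : TestCurve X) (g : X → ℝ≥0∞) :
    γ.integral g ≤ 2 * γ.symmIntegral g := by
  rw [← integral_add_integral_reverse]
  exact le_self_add

theorem integral_ne_top_of_symmIntegral_ne_top {γ : TestCurve X} {g : X → ℝ≥0∞}
    (h : γ.symmIntegral g ≠ ∞) : γ.integral g ≠ ∞ :=
  ((γ.integral_le_two_mul_symmIntegral g).trans_lt (ENNReal.mul_lt_top (by simp) h.lt_top)).ne

theorem ae_lt_top_of_integral_ne_top {γ : TestCurve X} {g : X → ℝ≥0∞}
    (hg : Measurable[borel X] g) (h : γ.integral g ≠ ∞) :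
    ∀ᵐ t ∂γ.variationMeasure, g (γ t) < ∞ :=
  ae_lt_top (hg.comp γ.measurable_borel) h

theorem IsNontrivial.exists_of_ae {γ : TestCurve X} (hγ : γ.IsNontrivial) {P : I → Prop}
    (h : ∀ᵐ t ∂γ.variationMeasure, P t) : ∃ t, P t := by
  have : NeZero γ.variationMeasure :=
    ⟨fun h0 => hγ.ne' (by rw [← γ.variationMeasure_univ, h0]; simp)⟩
  exact h.exists

theorem tendsto_integral_scaledTail (γ : TestCurve X) {g : X → ℝ≥0∞} (hg : Measurable[borel X] g)
    (h : γ.integral g ≠ ∞) :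
    Tendsto (fun k : ℕ => γ.integral (scaledTail g k)) atTop
      (𝓝 0) := by
  have hq : Measurable (fun t => g (γ t)) := hg.comp γ.measurable_borel
  have key := tendsto_lintegral_of_dominated_convergence (μ := γ.variationMeasure)
    (F := fun (k : ℕ) t => scaledTail g k (γ t))
    (f := fun _ => 0) (fun t => 8 * g (γ t))
    (fun k => (measurable_scaledTail hg k).comp γ.measurable_borel)
    (fun k => ae_of_all _ fun t => indicator_le_self _ _ _) ?_ ?_
  · rw [lintegral_zero] at key
    exact key
  · rw [lintegral_const_mul _ hq]
    exact ENNReal.mul_ne_top (by simp) h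
  · filter_upwards [ae_lt_top_of_integral_ne_top hg h] with t ht
    obtain ⟨n, hn⟩ := ENNReal.exists_nat_gt ht.ne
    refine tendsto_const_nhds.congr' ?_
    filter_upwards [eventually_ge_atTop n] with k hk
    exact (scaledTail_of_le (hn.le.trans (Nat.cast_le.2 hk))).symm

end TestCurve

section Truncation

variable {X : Type*} [MetricSpace X] {f : X → ℝ} {g : X → ℝ≥0∞}

theorem lipschitzOnWith_of_pointwise_hajlasz
    (H : ∀ x y, edist (f x) (f y) ≤ (g x + g y) * edist x y) (k : ℕ) :
    LipschitzOnWith (2 * k) f {x | g x ≤ k} := fun x hx y hy => by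
  refine (H x y).trans ?_
  gcongr
  refine (add_le_add hx hy).trans (le_of_eq ?_)
  push_cast
  ring

/-- If both points lie in `{g ≤ k}`, the extension is `f`. Otherwise its Lipschitz constant `2 * k`
is below `2 * g` at one of the points. -/
theorem edist_extension_le (H : ∀ x y, edist (f x) (f y) ≤ (g x + g y) * edist x y) {k : ℕ}
    {F : X → ℝ} (hF : LipschitzWith (2 * k) F) (hFf : EqOn f F {x | g x ≤ k}) (x y : X) :
    edist (F x) (F y) ≤ (2 * g x + 2 * g y) * edist x y := by
  by_cases hx : g x ≤ k
  · by_cases hy : g y ≤ k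
    · rw [← hFf hx, ← hFf hy]
      refine (H x y).trans ?_
      gcongr <;> exact le_mul_of_one_le_left' one_le_two
    · refine (hF x y).trans ?_
      gcongr
      push_cast
      exact le_add_left (mul_le_mul_right (not_le.1 hy).le 2)
  · refine (hF x y).trans ?_
    gcongr
    push_cast
    exact le_add_right (mul_le_mul_right (not_le.1 hx).le 2)

/-- The difference vanishes on `{g ≤ k}` and has gradient `4 g`. If just one point lies in `{g >
k}`, that point has the larger `g` and absorbs the other term, which doubles `4` to `8`. -/
theorem edist_sub_extension_le (H : ∀ x y, edist (f x) (f y) ≤ (g x + g y) * edist x y)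
    {k m : ℕ} (hkm : k ≤ m) {F F' : X → ℝ} (hF : LipschitzWith (2 * k) F)
    (hFf : EqOn f F {x | g x ≤ k}) (hF' : LipschitzWith (2 * m) F')
    (hFf' : EqOn f F' {x | g x ≤ m}) (x y : X) :
    edist (F' x - F x) (F' y - F y) ≤ (scaledTail g k x +
      scaledTail g k y) * edist x y := by
  have hkm' : (k : ℝ≥0∞) ≤ m := Nat.cast_le.2 hkm
  have h4 : edist (F' x - F x) (F' y - F y) ≤ (4 * g x + 4 * g y) * edist x y := by
    have h1 : edist (F' x - F x) (F' y - F y) ≤ edist (F' x) (F' y) + edist (F x) (F y) := by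
      simp only [edist_dist]
      rw [← ENNReal.ofReal_add dist_nonneg dist_nonneg]
      exact ENNReal.ofReal_le_ofReal (dist_sub_sub_le _ _ _ _)
    refine h1.trans ((add_le_add (edist_extension_le H hF' hFf' x y)
      (edist_extension_le H hF hFf x y)).trans (le_of_eq ?_))
    ring
  have hsum : ∀ a b : ℝ≥0∞, a ≤ b → 4 * a + 4 * b ≤ 8 * b := fun a b hab => by
    calc 4 * a + 4 * b ≤ 4 * b + 4 * b := by gcongr
      _ = 8 * b := by ring
  by_cases hx : g x ≤ k <;> by_cases hy : g y ≤ k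
  · rw [← hFf hx, ← hFf hy, ← hFf' (le_trans hx hkm' : _), ← hFf' (le_trans hy hkm' : _)]
    simp
  · rw [scaledTail_of_le hx, scaledTail_of_lt (not_le.1 hy), zero_add]
    refine h4.trans ?_
    gcongr
    exact hsum _ _ (hx.trans (not_le.1 hy).le)
  · rw [scaledTail_of_le hy, scaledTail_of_lt (not_le.1 hx), add_zero]
    refine h4.trans ?_
    gcongr
    rw [add_comm]
    exact hsum _ _ (hy.trans (not_le.1 hx).le)
  · rw [scaledTail_of_lt (not_le.1 hx), scaledTail_of_lt (not_le.1 hy)]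
    refine h4.trans ?_
    gcongr <;> norm_num

/-- A function with a pointwise Hajłasz gradient `g` agrees where `g` is finite with a Borel
function for which `20 g` is an upper `S`-gradient along every nontrivial test curve. -/
theorem exists_borel_representative (hg : Measurable[borel X] g)
    (H : ∀ x y, edist (f x) (f y) ≤ (g x + g y) * edist x y) :
    ∃ F : X → ℝ, Measurable[borel X] F ∧ (∀ x, g x < ∞ → F x = f x) ∧
      ∀ γ : TestCurve X, γ.IsNontrivial →
        edist (F (γ 1)) (F (γ 0)) ≤ γ.symmIntegral fun x => 10 * (2 * g x) := by
  choose φ hφ hφf using fun k : ℕ => (lipschitzOnWith_of_pointwise_hajlasz H k).extend_real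
  have hev : ∀ x, g x < ∞ → ∃ n : ℕ, ∀ k ≥ n, φ k x = f x := fun x hx => by
    obtain ⟨n, hn⟩ := ENNReal.exists_nat_gt hx.ne
    exact ⟨n, fun k hk => (hφf k (hn.le.trans (Nat.cast_le.2 hk) : g x ≤ k)).symm⟩
  -- The limsup is Borel everywhere; its value matters only where the extensions converge.
  refine ⟨fun x => limsup (fun k => φ k x) atTop, ?_, fun x hx => ?_, fun γ hγ => ?_⟩
  · let _ : MeasurableSpace X := borel X
    have : BorelSpace X := ⟨rfl⟩
    exact Measurable.limsup fun k => (hφ k).continuous.measurable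
  · obtain ⟨n, hn⟩ := hev x hx
    refine (tendsto_const_nhds.congr' ?_).limsup_eq
    filter_upwards [eventually_ge_atTop n] with k hk using (hn k hk).symm
  by_cases hfin : γ.symmIntegral g = ∞
  · refine le_top.trans (hfin.symm.le.trans (γ.symmIntegral_mono fun x => ?_))
    rw [← mul_assoc]
    exact le_mul_of_one_le_left' (by norm_num)
  have h1 : γ.integral g ≠ ∞ := TestCurve.integral_ne_top_of_symmIntegral_ne_top hfin
  have h2 : γ.reverse.integral g ≠ ∞ := TestCurve.integral_ne_top_of_symmIntegral_ne_top
    (by rwa [γ.symmIntegral_reverse])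
  have hlim : Tendsto (fun k : ℕ => 10 * γ.symmIntegral
      (scaledTail g k)) atTop (𝓝 0) := by
    have := ENNReal.Tendsto.const_mul (a := 5) ((γ.tendsto_integral_scaledTail hg h1).add
      (γ.reverse.tendsto_integral_scaledTail hg h2)) (Or.inr (by simp))
    rw [add_zero, mul_zero] at this
    refine this.congr fun k => ?_
    rw [TestCurve.integral_add_integral_reverse]
    ring
  -- An anchor: at `γ t` the extensions are eventually equal to `f`. Their differences elsewhere on
  -- `γ` are then bounded by the vanishing tail integrals, even at endpoints where `g` is infinite.
  obtain ⟨t, ht⟩ := hγ.exists_of_ae (TestCurve.ae_lt_top_of_integral_ne_top hg h1)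
  obtain ⟨n, hn⟩ := hev _ ht
  have hconv : ∀ s : I, ∃ a, Tendsto (fun k => φ k (γ s)) atTop (𝓝 a) := by
    intro s
    refine cauchySeq_tendsto_of_complete (EMetric.cauchySeq_iff'.2 fun ε hε => ?_)
    obtain ⟨N, hN⟩ := eventually_atTop.1 (hlim.eventually_lt_const hε)
    refine ⟨max n N, fun m hm => ?_⟩
    set k := max n N with hk
    have hsub := γ.edist_comp_le_symmIntegral (h := fun x => φ m x - φ k x)
      ((hφ m).sub (hφ k)) (measurable_scaledTail hg k)
      (edist_sub_extension_le H hm (hφ k) (hφf k) (hφ m) (hφf m)) s t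
    rw [hn m ((le_max_left _ _).trans hm), hn k (le_max_left _ _), sub_self] at hsub
    refine lt_of_le_of_lt (le_of_eq ?_) (hsub.trans_lt (hN k (le_max_right _ _)))
    rw [edist_dist, edist_dist, dist_zero_right, dist_eq_norm]
  obtain ⟨a, ha⟩ := hconv 1
  obtain ⟨b, hb⟩ := hconv 0
  simp only
  rw [ha.limsup_eq, hb.limsup_eq]
  refine le_of_tendsto (ha.edist hb) (Eventually.of_forall fun k => ?_)
  exact (γ.edist_comp_le_symmIntegral (hφ k) (hg.const_mul 2)
    (edist_extension_le H (hφ k) (hφf k)) 1 0).trans (γ.symmIntegral_const_mul_le 10 _)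

end Truncation

/-! ### Families of modulus zero. -/

namespace TestCurve

variable {X : Type*} [MetricSpace X]

theorem natCast_le_symmIntegral_sum (γ : TestCurve X) {ρ : ℕ → X → ℝ≥0∞}
    (h : ∀ j, 1 ≤ γ.symmIntegral (ρ j)) (n : ℕ) :
    (n : ℝ≥0∞) ≤ γ.symmIntegral (∑ j ∈ Finset.range n, ρ j) := by
  induction n with
  | zero => simp
  | succ n ih =>
    rw [Finset.sum_range_succ, Nat.cast_succ]
    exact (add_le_add ih (h n)).trans (γ.symmIntegral_add_le _ _)

end TestCurve

section ExceptionalFamily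

variable {X : Type*} [MetricSpace X] [MeasurableSpace X] {μ : Measure X} {p : ℝ≥0∞}

theorem exponent_toReal_pos (p : ℝ≥0∞) [hp1 : Fact (1 ≤ p)] [hp : Fact (p ≠ ∞)] :
    0 < p.toReal :=
  ENNReal.toReal_pos (zero_lt_one.trans_le hp1.out).ne' hp.out

theorem eLpNorm_iSup_le {α : Type*} {_ : MeasurableSpace α} {μ : Measure α} [Fact (1 ≤ p)]
    [hp : Fact (p ≠ ∞)] {S : ℕ → α → ℝ≥0∞} (hS : ∀ n, Measurable (S n)) (hmono : Monotone S)
    {C : ℝ≥0∞} (hC : ∀ n, eLpNorm (S n) p μ ≤ C) : eLpNorm (fun x => ⨆ n, S n x) p μ ≤ C := by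
  have hp0 := exponent_toReal_pos p
  have hpne : p ≠ 0 := fun h => by simp [h] at hp0
  have key : ∀ f : α → ℝ≥0∞, eLpNorm f p μ ≤ C ↔ ∫⁻ x, f x ^ p.toReal ∂μ ≤ C ^ p.toReal := by
    intro f
    rw [eLpNorm_eq_lintegral_rpow_enorm_toReal hpne hp.out, one_div,
      ENNReal.rpow_inv_le_iff hp0]
    simp
  rw [key]
  have : ∀ x, (⨆ n, S n x) ^ p.toReal = ⨆ n, S n x ^ p.toReal := fun x =>
    (ENNReal.orderIsoRpow p.toReal hp0).map_iSup _
  simp_rw [this]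
  rw [lintegral_iSup (fun n => (hS n).pow_const _)
    fun m n hmn x => ENNReal.rpow_le_rpow (hmono hmn x) hp0.le]
  exact iSup_le fun n => (key _).1 (hC n)

theorem ae_lt_top_of_eLpNorm_lt_top {α : Type*} {_ : MeasurableSpace α} {μ : Measure α}
    [Fact (1 ≤ p)] [hp : Fact (p ≠ ∞)] {f : α → ℝ≥0∞} (hf : Measurable f)
    (h : eLpNorm f p μ < ∞) : ∀ᵐ x ∂μ, f x < ∞ := by
  have hp0 := exponent_toReal_pos p
  have hpne : p ≠ 0 := fun h => by simp [h] at hp0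
  have h1 := lintegral_rpow_enorm_lt_top_of_eLpNorm_lt_top hpne hp.out h
  simp only [enorm_eq_self] at h1
  filter_upwards [ae_lt_top (hf.pow_const _) h1.ne] with x hx
  exact lt_of_not_ge fun h' => by
    rw [top_le_iff.1 h', ENNReal.top_rpow_of_pos hp0] at hx
    exact lt_irrefl _ hx

/-- Every positive multiple of `ρ` remains admissible, and its norm can be made arbitrarily small.
-/
theorem modulus_eq_zero_of_symmIntegral_eq_top [Fact (1 ≤ p)] [Fact (p ≠ ∞)]
    {Γ : Set (TestCurve X)} {ρ : X → ℝ≥0∞} (hρ : Measurable[borel X] ρ)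
    (hρp : eLpNorm ρ p μ < ∞) (h : ∀ γ ∈ Γ, γ.symmIntegral ρ = ∞) : modulus μ p Γ = 0 := by
  have hp0 := exponent_toReal_pos p
  have hlim : Tendsto (fun n : ℕ => (‖(1 / ((n : ℝ) + 1))‖ₑ * eLpNorm ρ p μ) ^ p.toReal) atTop
      (𝓝 0) := by
    have h1 : Tendsto (fun n : ℕ => ‖(1 / ((n : ℝ) + 1))‖ₑ) atTop (𝓝 0) := by
      simpa [Function.comp_def] using
        (continuous_enorm.tendsto (0 : ℝ)).comp tendsto_one_div_add_atTop_nhds_zero_nat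
    have h2 := (ENNReal.Tendsto.mul_const h1 (Or.inr hρp.ne)).ennrpow_const p.toReal
    rwa [zero_mul, ENNReal.zero_rpow_of_pos hp0] at h2
  refine nonpos_iff_eq_zero.1 (ge_of_tendsto' hlim fun n => ?_)
  refine iInf₂_le_of_le (fun x => ‖(1 / ((n : ℝ) + 1))‖ₑ * ρ x) ⟨hρ.const_mul _, fun γ hγ => ?_⟩
    (ENNReal.rpow_le_rpow (eLpNorm_const_mul_le_ennreal _ _) hp0.le)
  refine le_trans ?_ (γ.symmIntegral_const_mul_le _ ρ)
  rw [h γ hγ, ENNReal.mul_top]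
  · exact le_top
  · have : (1 / ((n : ℝ) + 1)) ≠ 0 := by positivity
    simpa using this

/-- Sum admissible functions of norm below `2⁻¹ ^ j`: the norms add up to at most `2`, while each
curve gains at least `1` from every term. -/
theorem exists_symmIntegral_eq_top_of_modulus_eq_zero [OpensMeasurableSpace X] [hp1 : Fact (1 ≤ p)]
    [Fact (p ≠ ∞)] {Γ : Set (TestCurve X)} (h : modulus μ p Γ = 0) :
    ∃ ρ : X → ℝ≥0∞, Measurable[borel X] ρ ∧ eLpNorm ρ p μ < ∞ ∧
      ∀ γ ∈ Γ, γ.symmIntegral ρ = ∞ := by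
  have hp0 := exponent_toReal_pos p
  have key : ∀ j : ℕ, ∃ ρ : X → ℝ≥0∞, (Measurable[borel X] ρ ∧
      ∀ γ ∈ Γ, 1 ≤ γ.symmIntegral ρ) ∧ eLpNorm ρ p μ < 2⁻¹ ^ j := by
    intro j
    have hpos : (0 : ℝ≥0∞) < (2⁻¹ ^ j) ^ p.toReal :=
      ENNReal.rpow_pos_of_nonneg (ENNReal.pow_pos (by simp) j) hp0.le
    rw [← h] at hpos
    unfold modulus at hpos
    simp only [iInf_lt_iff] at hpos
    obtain ⟨ρ, hρ, hlt⟩ := hpos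
    exact ⟨ρ, hρ, (ENNReal.rpow_lt_rpow_iff hp0).1 hlt⟩
  choose ρ hρ hρp using key
  let S : ℕ → X → ℝ≥0∞ := fun n => ∑ j ∈ Finset.range n, ρ j
  have hSm : ∀ n, Measurable[borel X] (S n) := fun n => by
    have := Finset.measurable_sum (Finset.range n) fun j _ => (hρ j).1
    simpa only [S, Finset.sum_fn] using this
  have hmono : Monotone S := fun m n hmn x => by
    simp only [S, Finset.sum_apply]
    exact Finset.sum_le_sum_of_subset (Finset.range_mono hmn)
  refine ⟨fun x => ⨆ n, S n x, Measurable.iSup hSm, ?_, fun γ hγ => ?_⟩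
  · refine (eLpNorm_iSup_le (C := 2) (fun n => Measurable.of_borel (hSm n)) hmono
      fun n => ?_).trans_lt (by simp)
    calc eLpNorm (S n) p μ ≤ ∑ j ∈ Finset.range n, eLpNorm (ρ j) p μ :=
          eLpNorm_sum_le (fun j _ => (Measurable.of_borel (hρ j).1).aestronglyMeasurable) hp1.out
      _ ≤ ∑ j ∈ Finset.range n, 2⁻¹ ^ j := Finset.sum_le_sum fun j _ => (hρp j).le
      _ ≤ ∑' j, 2⁻¹ ^ j := ENNReal.sum_le_tsum _
      _ = 2 := by rw [ENNReal.tsum_geometric, ENNReal.one_sub_inv_two, inv_inv]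
  · refine ENNReal.eq_top_of_forall_nnreal_le fun r => ?_
    obtain ⟨n, hn⟩ := exists_nat_ge r
    calc (r : ℝ≥0∞) ≤ (n : ℝ≥0∞) := by exact_mod_cast hn
      _ ≤ γ.symmIntegral (S n) := γ.natCast_le_symmIntegral_sum (fun j => (hρ j).2 γ hγ) n
      _ ≤ _ := γ.symmIntegral_mono fun x => le_iSup (fun n => S n x) n

end ExceptionalFamily

/-! ### Jump curves: weak upper `S`-gradients are Hajłasz gradients. -/

namespace TestCurve

variable {X : Type*} [MetricSpace X]

theorem leftLim_mem_of_isClosed (γ : TestCurve X) {s : Set X} (hs : IsClosed s)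
    (h : ∀ t, γ t ∈ s) (t : I) : Function.leftLim γ t ∈ s := by
  rcases eq_or_neBot (𝓝[<] t) with h0 | h0
  · rw [leftLim_eq_of_eq_bot _ h0]
    exact h t
  · exact hs.mem_of_tendsto (γ.tendsto_leftLim t) (Eventually.of_forall h)

theorem integral_le_of_forall_le (γ : TestCurve X) {g : X → ℝ≥0∞} {C : ℝ≥0∞}
    (h : ∀ t, g (γ t) ≤ C) : γ.integral g ≤ C * eVariationOn γ univ := by
  refine (lintegral_mono h).trans (le_of_eq ?_)
  rw [lintegral_const, γ.variationMeasure_univ]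

theorem eVariationOn_ite_le (x y : X) :
    eVariationOn (fun t : I => if (t : ℝ) < 1 / 2 then x else y) univ ≤ edist x y := by
  let c : Bool → X := fun b => if b then y else x
  let φ : I → Bool := fun t => decide (1 / 2 ≤ (t : ℝ))
  have hφ : MonotoneOn φ univ := fun a _ b _ hab => by
    have hab' : (a : ℝ) ≤ b := hab
    by_cases h : 1 / 2 ≤ (a : ℝ)
    · simp only [φ, h, h.trans hab', decide_true]
      exact le_rfl
    · simp only [φ, h, decide_false]
      exact Bool.false_le _
  have heq : (fun t : I => if (t : ℝ) < 1 / 2 then x else y) = c ∘ φ := by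
    funext t
    by_cases h : (t : ℝ) < 1 / 2
    · simp only [h, if_true, Function.comp, φ, not_le.2 h, decide_false, c]; rfl
    · simp only [h, if_false, Function.comp, φ, not_lt.1 h, decide_true, c]; rfl
  rw [heq]
  refine (eVariationOn.comp_le_of_monotoneOn c φ hφ (t := univ)
    (s := {false, true}) fun t _ => ?_).trans (le_of_eq ?_)
  · cases φ t <;> simp
  · rw [eVariationOn.pair]; rfl

/-- The test curve that sits at `x` and then jumps to `y`. -/
def jump (x y : X) : TestCurve X where
  toFun t := if (t : ℝ) < 1 / 2 then x else y
  boundedVariation := ((eVariationOn_ite_le x y).trans_lt (edist_lt_top x y)).ne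
  rightContinuous t _ := by
    by_cases h : (t : ℝ) < 1 / 2
    · refine ContinuousAt.continuousWithinAt (ContinuousAt.congr continuousAt_const
        (f := fun _ => x) ?_)
      filter_upwards [(continuous_subtype_val.tendsto t).eventually_lt_const h] with s hs
      rw [if_pos hs]
    · refine (continuousWithinAt_const (b := y)).congr (fun s hs => ?_) (if_neg h)
      exact if_neg (not_lt.2 ((not_lt.1 h).trans hs))
  leftContinuous_one := by
    have h : (1 / 2 : ℝ) < ((1 : I) : ℝ) := by norm_num
    refine ContinuousAt.continuousWithinAt (ContinuousAt.congr continuousAt_const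
      (f := fun _ => y) ?_)
    filter_upwards [(continuous_subtype_val.tendsto (1 : I)).eventually_const_lt h] with s hs
    rw [if_neg (not_lt.2 hs.le)]
  exists_leftLim t _ _ := by
    by_cases h : (t : ℝ) ≤ 1 / 2
    · refine ⟨x, tendsto_const_nhds.congr' ?_⟩
      filter_upwards [self_mem_nhdsWithin] with s hs
      rw [if_pos (lt_of_lt_of_le hs h)]
    · refine ⟨y, tendsto_const_nhds.congr' (EventuallyEq.filter_mono ?_ nhdsWithin_le_nhds)⟩
      filter_upwards [(continuous_subtype_val.tendsto t).eventually_const_lt (not_le.1 h)] with s hs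
      rw [if_neg (not_lt.2 hs.le)]

theorem jump_zero (x y : X) : jump x y 0 = x := if_pos (by norm_num)

theorem jump_one (x y : X) : jump x y 1 = y := if_neg (by norm_num)

theorem jump_mem (x y : X) (t : I) : jump x y t ∈ ({x, y} : Set X) := by
  change (if (t : ℝ) < 1 / 2 then x else y) ∈ _
  split_ifs <;> simp

theorem isNontrivial_jump {x y : X} (h : x ≠ y) : (jump x y).IsNontrivial := by
  refine (edist_pos.2 h).trans_le ?_
  have := eVariationOn.edist_le (jump x y) (mem_univ (0 : I)) (mem_univ (1 : I))
  rwa [jump_zero, jump_one] at this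

theorem symmIntegral_jump_le (x y : X) (g : X → ℝ≥0∞) :
    (jump x y).symmIntegral g ≤ (g x + g y) * edist x y := by
  have hmem : ∀ z ∈ ({x, y} : Set X), g z ≤ g x + g y := by
    rintro z (rfl | rfl)
    · exact le_self_add
    · exact le_add_self
  have hvar : eVariationOn (jump x y) univ ≤ edist x y := eVariationOn_ite_le x y
  have h1 : (jump x y).integral g ≤ (g x + g y) * edist x y :=
    ((jump x y).integral_le_of_forall_le fun t => hmem _ (jump_mem x y t)).trans
      (mul_le_mul_right hvar _)
  have h2 : (jump x y).reverse.integral g ≤ (g x + g y) * edist x y :=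
    ((jump x y).reverse.integral_le_of_forall_le fun t => hmem _
      ((jump x y).leftLim_mem_of_isClosed (toFinite _).isClosed (jump_mem x y) _)).trans
      (mul_le_mul_right ((jump x y).eVariationOn_reverse_le.trans hvar) _)
  calc (jump x y).symmIntegral g ≤ ((g x + g y) * edist x y + (g x + g y) * edist x y) / 2 :=
        ENNReal.div_le_div_right (add_le_add h1 h2) 2
    _ = (g x + g y) * edist x y := by rw [← two_mul, mul_comm, ENNReal.mul_div_cancel_right] <;> simp

end TestCurve

section

variable {X : Type*} [MetricSpace X] [MeasurableSpace X] [OpensMeasurableSpace X]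
  {μ : Measure X} {p : ℝ≥0∞} [Fact (1 ≤ p)] [Fact (p ≠ ∞)]

/-- The exceptional null set is `{ρ = ∞}` for a `ρ` in `L^p` with infinite integral over every bad
curve: a jump between two points outside it has finite `ρ`-integral, so it is a good curve. -/
theorem IsWeakUpperSGradient.isHajlaszGradient {f : X → ℝ} {g : X → ℝ≥0∞}
    (h : IsWeakUpperSGradient μ p f g) : IsHajlaszGradient μ f g := by
  obtain ⟨ρ, hρ, hρp, hΓ⟩ := exists_symmIntegral_eq_top_of_modulus_eq_zero h.2
  have hρ' : Measurable ρ := Measurable.of_borel hρ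
  refine ⟨Measurable.of_borel h.1, ρ ⁻¹' {∞}, hρ' (measurableSet_singleton _), ?_,
    fun x hx y hy => ?_⟩
  · have := ae_lt_top_of_eLpNorm_lt_top hρ' hρp
    rw [ae_iff] at this
    convert this using 2
    ext x
    simp
  by_cases hxy : x = y
  · simp [hxy]
  by_contra hcon
  have hmem : TestCurve.jump x y ∈ {γ : TestCurve X | γ.IsNontrivial ∧
      ¬ ENNReal.ofReal |f (γ 1) - f (γ 0)| ≤ γ.symmIntegral g} := by
    refine ⟨TestCurve.isNontrivial_jump hxy, fun hle => hcon ?_⟩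
    rw [TestCurve.jump_zero, TestCurve.jump_one] at hle
    exact hle.trans (TestCurve.symmIntegral_jump_le x y g)
  have htop := hΓ _ hmem
  refine (htop ▸ TestCurve.symmIntegral_jump_le x y ρ).not_gt (ENNReal.mul_lt_top
    (ENNReal.add_lt_top.2 ⟨lt_top_iff_ne_top.2 hx, lt_top_iff_ne_top.2 hy⟩) (edist_lt_top x y))

end

/-! ### Frozen curves, and functions vanishing almost everywhere. -/

namespace TestCurve

variable {X : Type*} [MetricSpace X]

/-- The test curve `γ` frozen from time `t` on. -/
def freeze (γ : TestCurve X) (t : I) : TestCurve X where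
  toFun w := γ (min w t)
  boundedVariation :=
    ((eVariationOn.comp_le_of_monotoneOn γ.toFun (s := univ) (t := univ) (fun w : I => min w t)
      (fun _ _ _ _ h => min_le_min_right t h) (fun _ _ => mem_univ _)).trans_lt
        γ.boundedVariation.lt_top).ne
  rightContinuous w _ := (γ.continuousWithinAt_Ici (min w t)).comp
    (f := fun w => min w t) (continuous_id.min continuous_const).continuousWithinAt
    fun _ h => min_le_min_right t h
  leftContinuous_one := by
    rcases (unitInterval.le_one' (t := t)).eq_or_lt with h | h
    · refine γ.leftContinuous_one.congr (fun w hw => ?_) ?_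
      · rw [h, min_eq_left hw]
      · rw [h, min_self]
    · refine ContinuousAt.continuousWithinAt (ContinuousAt.congr continuousAt_const
        (f := fun _ => γ t) ?_)
      filter_upwards [Ioi_mem_nhds h] with w hw
      rw [min_eq_right (le_of_lt hw)]
  exists_leftLim w _ _ := by
    rcases le_or_gt w t with h | h
    · refine ⟨_, (γ.tendsto_leftLim w).congr' ?_⟩
      filter_upwards [self_mem_nhdsWithin] with r hr
      rw [min_eq_left ((le_of_lt hr).trans h)]
    · refine ⟨γ t, tendsto_const_nhds.congr' ?_⟩
      filter_upwards [mem_nhdsWithin_of_mem_nhds (Ioi_mem_nhds h)] with r hr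
      rw [min_eq_right (le_of_lt hr)]

theorem freeze_apply (γ : TestCurve X) (t w : I) : γ.freeze t w = γ (min w t) := rfl

theorem leftLim_freeze_of_le (γ : TestCurve X) {t w : I} (h : w ≤ t) :
    Function.leftLim (γ.freeze t) w = Function.leftLim γ w := by
  rcases eq_or_neBot (𝓝[<] w) with h0 | h0
  · rw [leftLim_eq_of_eq_bot _ h0, leftLim_eq_of_eq_bot _ h0, freeze_apply, min_eq_left h]
  · refine leftLim_eq_of_tendsto ((γ.tendsto_leftLim w).congr' ?_)
    filter_upwards [self_mem_nhdsWithin] with r hr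
    rw [freeze_apply, min_eq_left ((le_of_lt hr).trans h)]

theorem leftLim_freeze_of_lt (γ : TestCurve X) {t w : I} (h : t < w) :
    Function.leftLim (γ.freeze t) w = γ t := by
  have : (𝓝[<] w).NeBot := nhdsLT_neBot_of_exists_lt ⟨t, h⟩
  refine leftLim_eq_of_tendsto (tendsto_const_nhds.congr' ?_)
  filter_upwards [mem_nhdsWithin_of_mem_nhds (Ioi_mem_nhds h)] with r hr
  rw [freeze_apply, min_eq_right (le_of_lt hr)]

theorem eVariationOn_freeze_le (γ : TestCurve X) (t r s : I) :
    eVariationOn (γ.freeze t) (Icc r s) ≤ eVariationOn γ (Icc r s) := by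
  rcases le_or_gt r t with h | h
  · exact eVariationOn.comp_le_of_monotoneOn γ.toFun (fun w : I => min w t)
      (fun _ _ _ _ h => min_le_min_right t h)
      (fun w hw => ⟨le_min hw.1 h, (min_le_left _ _).trans hw.2⟩)
  · refine (eVariationOn.constant_on ?_).le.trans zero_le
    rintro _ ⟨a, ha, rfl⟩ _ ⟨b, hb, rfl⟩
    rw [freeze_apply, freeze_apply, min_eq_right (h.le.trans ha.1), min_eq_right (h.le.trans hb.1)]

theorem variationMeasure_freeze_Ioi (γ : TestCurve X) (t : I) :
    (γ.freeze t).variationMeasure (Ioi t) = 0 := by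
  have h : Ioi t = Ioc t 1 := by ext s; simp [unitInterval.le_one']
  rw [h, variationMeasure_Ioc _ unitInterval.le_one']
  refine eVariationOn.constant_on ?_
  rintro _ ⟨a, ha, rfl⟩ _ ⟨b, hb, rfl⟩
  rw [freeze_apply, freeze_apply, min_eq_right ha.1, min_eq_right hb.1]

theorem integral_freeze_le (γ : TestCurve X) (t : I) (g : X → ℝ≥0∞) :
    (γ.freeze t).integral g ≤ ∫⁻ w in Iic t, g (γ w) ∂γ.variationMeasure := by
  have h0 : (γ.freeze t).variationMeasure (Iic t)ᶜ = 0 := by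
    rw [compl_Iic, variationMeasure_freeze_Ioi]
  rw [integral, ← Measure.restrict_eq_self_of_ae_mem (mem_ae_iff.2 h0)]
  calc ∫⁻ w in Iic t, g (γ.freeze t w) ∂(γ.freeze t).variationMeasure
      = ∫⁻ w in Iic t, g (γ w) ∂(γ.freeze t).variationMeasure :=
        setLIntegral_congr_fun measurableSet_Iic fun w hw => by
          rw [freeze_apply, min_eq_left hw]
    _ ≤ _ := lintegral_mono' (Measure.restrict_mono le_rfl (variationMeasure_mono _ _
        fun r s _ => γ.eVariationOn_freeze_le t r s)) le_rfl

theorem reverse_freeze_of_le (γ : TestCurve X) {t w : I} (h : unitInterval.symm t ≤ w) :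
    (γ.freeze t).reverse w = γ.reverse w :=
  γ.leftLim_freeze_of_le (unitInterval.symm_le_comm.1 h)

theorem reverse_freeze_of_lt (γ : TestCurve X) {t w : I} (h : w < unitInterval.symm t) :
    (γ.freeze t).reverse w = γ t :=
  γ.leftLim_freeze_of_lt (unitInterval.lt_symm_comm.1 h)

/-- The reversed frozen curve waits at `γ t` until time `a = 1 - t`. When `a` is interior, it is the
limit as `b ↑ a` of monotone reparametrizations of `γ.reverse` that wait at time `b`, since the left
limit of `γ.reverse` at `a` is `γ t`; lower semicontinuity of the variation concludes. -/
theorem eVariationOn_reverse_freeze_le (γ : TestCurve X) (t r s : I) :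
    eVariationOn (γ.freeze t).reverse (Icc r s) ≤ eVariationOn γ.reverse (Icc r s) := by
  set a := unitInterval.symm t with ha
  rcases le_or_gt a r with h | har
  · exact (eVariationOn.congr fun w hw => γ.reverse_freeze_of_le (h.trans hw.1)).le
  rcases lt_or_ge s a with h | has
  · refine (eVariationOn.constant_on ?_).le.trans zero_le
    rintro _ ⟨c, hc, rfl⟩ _ ⟨d, hd, rfl⟩
    rw [γ.reverse_freeze_of_lt (hc.2.trans_lt h), γ.reverse_freeze_of_lt (hd.2.trans_lt h)]
  let F : I → I → X := fun b w => γ.reverse (if w < a then b else w)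
  have hne : (𝓝[<] a).NeBot := nhdsLT_neBot_of_exists_lt ⟨r, har⟩
  have hF : ∀ w ∈ Icc r s, Tendsto (fun b => F b w) (𝓝[<] a) (𝓝 ((γ.freeze t).reverse w)) := by
    intro w _
    by_cases hw : w < a
    · simp only [F, hw, if_true]
      rw [γ.reverse_freeze_of_lt hw]
      have := γ.reverse.tendsto_leftLim a
      rwa [leftLim_reverse, ha, unitInterval.symm_symm] at this
    · simp only [F, hw, if_false]
      rw [γ.reverse_freeze_of_le (not_lt.1 hw)]
      exact tendsto_const_nhds
  refine le_of_forall_lt fun v hv => ?_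
  obtain ⟨b, hb, hrb, hba⟩ := ((eVariationOn.lowerSemicontinuous_aux hF hv).and
    (Ico_mem_nhdsLT har)).exists
  refine hb.trans_le (eVariationOn.comp_le_of_monotoneOn γ.reverse.toFun
    (fun w => if w < a then b else w) (fun c _ d _ hcd => ?_) fun w hw => ?_)
  · simp only
    split_ifs with h1 h2 h2
    · exact le_rfl
    · exact hba.le.trans (not_lt.1 h2)
    · exact absurd (hcd.trans_lt h2) h1
    · exact hcd
  · simp only
    split_ifs
    · exact ⟨hrb, hba.le.trans has⟩
    · exact hw

theorem variationMeasure_reverse_freeze_Iio (γ : TestCurve X) (t : I) :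
    (γ.freeze t).reverse.variationMeasure (Iio (unitInterval.symm t)) = 0 := by
  refine measure_null_of_locally_null _ fun w hw => ?_
  obtain ⟨y, hwy, hy⟩ := exists_between (mem_Iio.1 hw)
  refine ⟨Iic y, mem_nhdsWithin_of_mem_nhds (Iic_mem_nhds hwy), ?_⟩
  rw [variationMeasure_Iic]
  refine eVariationOn.constant_on ?_
  rintro _ ⟨c, hc, rfl⟩ _ ⟨d, hd, rfl⟩
  rw [γ.reverse_freeze_of_lt (hc.2.trans_lt hy), γ.reverse_freeze_of_lt (hd.2.trans_lt hy)]

theorem integral_reverse_freeze_le (γ : TestCurve X) (t : I) (g : X → ℝ≥0∞) :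
    (γ.freeze t).reverse.integral g ≤
      ∫⁻ w in Ici (unitInterval.symm t), g (γ.reverse w) ∂γ.reverse.variationMeasure := by
  have h0 : (γ.freeze t).reverse.variationMeasure (Ici (unitInterval.symm t))ᶜ = 0 := by
    rw [compl_Ici, variationMeasure_reverse_freeze_Iio]
  rw [integral, ← Measure.restrict_eq_self_of_ae_mem (mem_ae_iff.2 h0)]
  calc ∫⁻ w in Ici (unitInterval.symm t), g ((γ.freeze t).reverse w)
        ∂(γ.freeze t).reverse.variationMeasure
      = ∫⁻ w in Ici (unitInterval.symm t), g (γ.reverse w)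
        ∂(γ.freeze t).reverse.variationMeasure :=
        setLIntegral_congr_fun measurableSet_Ici fun w hw => by
          rw [γ.reverse_freeze_of_le hw]
    _ ≤ _ := lintegral_mono' (Measure.restrict_mono le_rfl (variationMeasure_mono _ _
        fun r s _ => γ.eVariationOn_reverse_freeze_le t r s)) le_rfl

/-- The measure of `(-∞, t]` bounds the symmetrized integral of `g` over `γ` frozen from `t` on. -/
def initialMeasure (γ : TestCurve X) (g : X → ℝ≥0∞) : Measure I :=
  γ.variationMeasure.withDensity (fun w => g (γ w)) +
    (γ.reverse.variationMeasure.withDensity fun w => g (γ.reverse w)).map unitInterval.symm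

theorem measurable_symm : Measurable unitInterval.symm :=
  unitInterval.continuous_symm.measurable

theorem symm_preimage_Iic (t : I) :
    unitInterval.symm ⁻¹' Iic t = Ici (unitInterval.symm t) := by
  ext w
  simp only [mem_preimage, mem_Iic, mem_Ici]
  exact unitInterval.symm_le_comm

theorem symmIntegral_freeze_le (γ : TestCurve X) (t : I) (g : X → ℝ≥0∞) :
    (γ.freeze t).symmIntegral g ≤ γ.initialMeasure g (Iic t) := by
  rw [initialMeasure, Measure.add_apply, Measure.map_apply measurable_symm measurableSet_Iic,
    symm_preimage_Iic, withDensity_apply _ measurableSet_Iic,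
    withDensity_apply _ measurableSet_Ici]
  refine le_trans ENNReal.half_le_self ?_
  exact add_le_add (γ.integral_freeze_le t g) (γ.integral_reverse_freeze_le t g)

theorem initialMeasure_univ (γ : TestCurve X) (g : X → ℝ≥0∞) :
    γ.initialMeasure g univ = 2 * γ.symmIntegral g := by
  rw [initialMeasure, Measure.add_apply, Measure.map_apply measurable_symm MeasurableSet.univ,
    preimage_univ, withDensity_apply _ MeasurableSet.univ, withDensity_apply _ MeasurableSet.univ,
    setLIntegral_univ, setLIntegral_univ, ← integral_add_integral_reverse]
  rfl

theorem initialMeasure_Iic_eq_zero (γ : TestCurve X) (g : X → ℝ≥0∞) {t : I}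
    (h1 : γ.variationMeasure (Iic t) = 0)
    (h2 : γ.reverse.variationMeasure (Ici (unitInterval.symm t)) = 0) :
    γ.initialMeasure g (Iic t) = 0 := by
  rw [initialMeasure, Measure.add_apply, Measure.map_apply measurable_symm measurableSet_Iic,
    symm_preimage_Iic, withDensity_absolutelyContinuous _ _ h1,
    withDensity_absolutelyContinuous _ _ h2, add_zero]

theorem symmIntegral_freeze_ne_top {γ : TestCurve X} {g : X → ℝ≥0∞} (h : γ.symmIntegral g ≠ ∞)
    (t : I) : (γ.freeze t).symmIntegral g ≠ ∞ := by
  refine ((γ.symmIntegral_freeze_le t g).trans_lt ?_).ne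
  refine (measure_mono (subset_univ _)).trans_lt ?_
  rw [initialMeasure_univ]
  exact ENNReal.mul_lt_top (by simp) h.lt_top

theorem variationMeasure_preimage_eq_zero {γ : TestCurve X} {g : X → ℝ≥0∞}
    (hg : Measurable[borel X] g) (h : γ.integral g ≠ ∞) {E : Set X} (hE : ∀ x ∈ E, g x = ∞) :
    γ.variationMeasure {t | γ t ∈ E} = 0 := by
  refine measure_mono_null (fun t ht => ?_) (ae_iff.1 (ae_lt_top_of_integral_ne_top hg h))
  exact not_lt.2 (hE _ ht).ge

/-- If `u` vanishes off `E`, the function `ρ` is infinite on `E`, and `g` controls `u` along all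
curves of finite `ρ`-length, then `u` vanishes at the starting points of such curves. -/
theorem apply_start_eq_zero {u : X → ℝ} {ρ g : X → ℝ≥0∞} {E : Set X} (hu : ∀ x ∉ E, u x = 0)
    (hρ : Measurable[borel X] ρ) (hE : ∀ x ∈ E, ρ x = ∞)
    (H : ∀ γ : TestCurve X, γ.IsNontrivial → γ.symmIntegral ρ ≠ ∞ →
      ENNReal.ofReal |u (γ 1) - u (γ 0)| ≤ γ.symmIntegral g)
    {γ : TestCurve X} (hγ : γ.IsNontrivial) (hγρ : γ.symmIntegral ρ ≠ ∞)
    (hγg : γ.symmIntegral g ≠ ∞) : u (γ 0) = 0 := by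
  by_cases h0 : γ 0 ∈ E
  swap
  · exact hu _ h0
  by_contra hne
  have hfin1 := integral_ne_top_of_symmIntegral_ne_top hγρ
  have hfin2 := integral_ne_top_of_symmIntegral_ne_top (γ := γ.reverse) (g := ρ)
    (by rwa [symmIntegral_reverse])
  have hnull := variationMeasure_preimage_eq_zero hρ hfin1 hE
  have hnull' := variationMeasure_preimage_eq_zero hρ hfin2 hE
  -- Freezing at a time outside `E` gives a nontrivial curve from `γ 0` to a zero of `u`.
  have hbound : ∀ t, γ t ∉ E → ENNReal.ofReal |u (γ 0)| ≤ γ.initialMeasure g (Iic t) := by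
    intro t ht
    have e1 : γ.freeze t 1 = γ t := by rw [freeze_apply, min_eq_right unitInterval.le_one']
    have e0 : γ.freeze t 0 = γ 0 := by rw [freeze_apply, min_eq_left unitInterval.nonneg']
    have hnt : (γ.freeze t).IsNontrivial := by
      refine lt_of_lt_of_le (edist_pos.2 fun h => ?_) (eVariationOn.edist_le (γ.freeze t)
        (mem_univ (0 : I)) (mem_univ (1 : I)))
      rw [e0, e1] at h
      exact ht (h ▸ h0)
    have := H (γ.freeze t) hnt (symmIntegral_freeze_ne_top hγρ t)
    rw [e1, e0, hu _ ht, zero_sub, abs_neg] at this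
    exact this.trans (γ.symmIntegral_freeze_le t g)
  set T : Set I := {t | γ t ∉ E}
  -- The aim is that `γ` has not moved by the first exit time `t₀` from `E`, so that
  -- `initialMeasure` gives no mass to `[0, t₀]`.
  obtain ⟨t₁, ht₁⟩ : T.Nonempty := hγ.exists_of_ae (P := fun t => γ t ∉ E)
    (by rw [ae_iff]; simpa using hnull)
  set t₀ := sInf T with ht₀
  have hbelow : ∀ t < t₀, γ t ∈ E := fun t ht => by
    by_contra h
    exact ht.not_ge (sInf_le h)
  have hIio : γ.variationMeasure (Iio t₀) = 0 := measure_mono_null hbelow hnull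
  have hconst : ∀ t < t₀, γ t = γ 0 := fun t ht => by
    have h1 : eVariationOn γ (Icc 0 t) = 0 := by
      rw [← variationMeasure_Iic]
      exact measure_mono_null (fun s hs => lt_of_le_of_lt hs ht) hIio
    have h2 := eVariationOn.edist_le γ.toFun (left_mem_Icc.2 (unitInterval.nonneg' (t := t)))
      (right_mem_Icc.2 unitInterval.nonneg')
    rw [h1] at h2
    exact (edist_le_zero.1 h2).symm
  have hleft : ∀ t ≤ t₀, Function.leftLim γ t = γ 0 := fun t ht => by
    rcases (unitInterval.nonneg' (t := t)).eq_or_lt with h | h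
    · rw [← h, leftLim_zero]
    · have : (𝓝[<] t).NeBot := nhdsLT_neBot_of_exists_lt ⟨0, h⟩
      refine leftLim_eq_of_tendsto (tendsto_const_nhds.congr' ?_)
      filter_upwards [self_mem_nhdsWithin] with r hr
      exact (hconst r (lt_of_lt_of_le hr ht)).symm
  -- The reversed curve stays at `γ 0`, a point of `E`, from time `1 - t₀` on. The absence of an
  -- atom there rules out a jump of `γ` at `t₀`, which `hIio` alone does not exclude.
  have hIci : γ.reverse.variationMeasure (Ici (unitInterval.symm t₀)) = 0 := by
    refine measure_mono_null (fun w hw => ?_) hnull'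
    change Function.leftLim γ (unitInterval.symm w) ∈ E
    rw [hleft _ (unitInterval.symm_le_comm.1 hw)]
    exact h0
  have hstart : γ t₀ = γ 0 := by
    have h1 := (γ.edist_leftLim_le_variationMeasure_reverse t₀).trans
      (measure_mono (singleton_subset_iff.2 (mem_Ici.2 le_rfl)))
    rw [hIci, hleft _ le_rfl] at h1
    exact (edist_le_zero.1 h1).symm
  have hIic : γ.variationMeasure (Iic t₀) = 0 := by
    refine measure_mono_null (fun t ht => ?_) hnull
    rcases (mem_Iic.1 ht).eq_or_lt with rfl | h
    · change γ _ ∈ E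
      rw [hstart]
      exact h0
    · exact hbelow t h
  have hzero := γ.initialMeasure_Iic_eq_zero g hIic hIci
  have : IsFiniteMeasure (γ.initialMeasure g) :=
    ⟨by rw [initialMeasure_univ]; exact ENNReal.mul_lt_top (by simp) hγg.lt_top⟩
  have hpos : γ.initialMeasure g (Iic t₀) < ENNReal.ofReal |u (γ 0)| := by
    rw [hzero]
    exact ENNReal.ofReal_pos.2 (abs_pos.2 hne)
  -- Outer regularity extends the smallness slightly beyond `t₀`, where `hbound` applies to some
  -- time in `T`.
  obtain ⟨U, hU, hUo, hUlt⟩ := (Iic t₀).exists_isOpen_lt_of_lt _ hpos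
  have ht₀₁ : t₀ < t₁ := (sInf_le ht₁).lt_of_ne fun h => ht₁ (by rw [← h, hstart]; exact h0)
  obtain ⟨b, hb, hbU⟩ := (mem_nhdsGE_iff_exists_Ico_subset' ht₀₁).1
    (mem_nhdsWithin_of_mem_nhds (hUo.mem_nhds (hU (mem_Iic.2 le_rfl))))
  obtain ⟨t, ht, htb⟩ := sInf_lt_iff.1 (mem_Ioi.1 hb)
  refine (hbound t ht).not_gt (lt_of_le_of_lt (measure_mono fun w hw => ?_) hUlt)
  rcases le_or_gt w t₀ with h | h
  · exact hU h
  · exact hbU ⟨h.le, lt_of_le_of_lt hw htb⟩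

end TestCurve

theorem eLpNorm_indicator_top_of_null {α : Type*} {_ : MeasurableSpace α} {μ : Measure α}
    {p : ℝ≥0∞} {E : Set α} (hE0 : μ E = 0) :
    eLpNorm (E.indicator fun _ => (∞ : ℝ≥0∞)) p μ = 0 := by
  have : (E.indicator fun _ => (∞ : ℝ≥0∞)) =ᵐ[μ] 0 := by
    filter_upwards [measure_eq_zero_iff_ae_notMem.1 hE0] with x hx
    exact indicator_of_notMem hx _
  rw [eLpNorm_congr_ae this, eLpNorm_zero]

section

variable {X : Type*} [MetricSpace X] [MeasurableSpace X] [OpensMeasurableSpace X]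
  {μ : Measure X} {p : ℝ≥0∞} [Fact (1 ≤ p)] [Fact (p ≠ ∞)]

/-- A function in the TC-Newtonian class that vanishes almost everywhere has `0` as a `p`-weak
upper `S`-gradient. -/
theorem IsWeakUpperSGradient.zero_of_ae_eq_zero (hμ : IsBorelRegular μ) {u : X → ℝ}
    (hum : Measurable u) (hu : u =ᵐ[μ] 0) {g : X → ℝ≥0∞} (h : IsWeakUpperSGradient μ p u g)
    (hgp : eLpNorm g p μ < ∞) : IsWeakUpperSGradient μ p u 0 := by
  refine ⟨@measurable_const _ _ _ (borel X) 0, ?_⟩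
  obtain ⟨ρ, hρ, hρp, hΓ⟩ := exists_symmIntegral_eq_top_of_modulus_eq_zero h.2
  obtain ⟨E, hEsub, hE, hEμ⟩ := hμ {x | u x ≠ 0} (hum (measurableSet_singleton 0)).compl
  have hE0 : μ E = 0 := hEμ.trans hu
  have hEm : MeasurableSet E := OpensMeasurableSpace.borel_le _ hE
  let χ : X → ℝ≥0∞ := E.indicator fun _ => ∞
  have hχ : Measurable[borel X] χ := (@measurable_const _ _ _ (borel X) ∞).indicator hE
  have hρχ : Measurable[borel X] (ρ + χ) := hρ.add hχ
  have hσ : Measurable[borel X] (ρ + χ + g) := hρχ.add h.1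
  -- Finiteness of the integral of `ρ + χ + g` excludes the bad curves of `g`, variation spent in
  -- `E`, and infinite `g`-integral, all at once.
  refine modulus_eq_zero_of_symmIntegral_eq_top hσ ?_ ?_
  · refine (eLpNorm_add_le_borel (Measurable.of_borel hρχ) (Measurable.of_borel h.1)).trans_lt
      (ENNReal.add_lt_top.2 ⟨?_, hgp⟩)
    refine (eLpNorm_add_le_borel (Measurable.of_borel hρ) (Measurable.of_borel hχ)).trans_lt
      (ENNReal.add_lt_top.2 ⟨hρp, ?_⟩)
    rw [eLpNorm_indicator_top_of_null hE0]
    exact ENNReal.zero_lt_top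
  rintro γ ⟨hγ, hfail⟩
  by_contra hfin
  have key : ∀ γ : TestCurve X, γ.IsNontrivial → γ.symmIntegral (ρ + χ + g) ≠ ∞ → u (γ 0) = 0 := by
    intro γ hγ hfin
    have h1 : γ.symmIntegral (ρ + χ) ≠ ∞ :=
      ((γ.symmIntegral_mono fun x => le_self_add).trans_lt hfin.lt_top).ne
    have h2 : γ.symmIntegral g ≠ ∞ :=
      ((γ.symmIntegral_mono fun x => le_add_self).trans_lt hfin.lt_top).ne
    refine TestCurve.apply_start_eq_zero (ρ := ρ + χ) (g := g) (E := E)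
      (fun x hx => not_not.1 fun h => hx (hEsub h)) hρχ (fun x hx => ?_) (fun γ' hγ' hfin' => ?_)
      hγ h1 h2
    · rw [Pi.add_apply, show χ x = ∞ from indicator_of_mem hx _, add_top]
    · by_contra hcon
      refine hfin' (top_le_iff.1 ?_)
      rw [← hΓ γ' ⟨hγ', hcon⟩]
      exact γ'.symmIntegral_mono fun x => le_self_add
  refine hfail ?_
  have e0 := key γ hγ hfin
  -- The reversed curve starts at `γ(1⁻) = γ 1`.
  have e1 := key γ.reverse hγ.reverse (by rwa [γ.symmIntegral_reverse])
  rw [TestCurve.reverse_apply, unitInterval.symm_zero, TestCurve.leftLim_one] at e1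
  simp [e0, e1]

end

/-! ### Borel versions of Hajłasz gradients. -/

section BorelMajorant

variable {X : Type*} [MetricSpace X] [MeasurableSpace X] {μ : Measure X}

/-- Equal measures give a null difference only when they are finite, so the Borel hulls are taken
piecewise along an exhaustion by sets of finite measure. -/
theorem IsBorelRegular.exists_superset_diff_null [SigmaFinite μ] (hμ : IsBorelRegular μ)
    {A : Set X} (hA : MeasurableSet A) :
    ∃ B, A ⊆ B ∧ MeasurableSet[borel X] B ∧ μ (B \ A) = 0 := by
  have hAn : ∀ n, MeasurableSet (A ∩ spanningSets μ n) := fun n =>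
    hA.inter (measurableSet_spanningSets μ n)
  choose B hAB hB hBμ using fun n => hμ _ (hAn n)
  have hfin : ∀ n, μ (A ∩ spanningSets μ n) ≠ ∞ := fun n =>
    ((measure_mono inter_subset_right).trans_lt (measure_spanningSets_lt_top μ n)).ne
  refine ⟨⋃ n, B n, fun x hx => ?_, MeasurableSet.iUnion hB, ?_⟩
  · obtain ⟨n, hn⟩ := mem_iUnion.1 ((iUnion_spanningSets μ).symm ▸ mem_univ x)
    exact mem_iUnion.2 ⟨n, hAB n ⟨hx, hn⟩⟩
  · rw [iUnion_sdiff]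
    refine measure_iUnion_null fun n => ?_
    refine measure_mono_null (t := B n \ (A ∩ spanningSets μ n))
      (sdiff_subset_sdiff_right inter_subset_left) ?_
    rw [measure_sdiff (hAB n) (hAn n).nullMeasurableSet (hfin n), hBμ n, tsub_self]

/-- Write `g` as the supremum of `c q` on `{c q < g}` over rational `q`, and enlarge each superlevel
set to a Borel hull. -/
theorem IsBorelRegular.exists_borel_ge [SigmaFinite μ] (hμ : IsBorelRegular μ)
    {g : X → ℝ≥0∞} (hg : Measurable g) :
    ∃ g' : X → ℝ≥0∞, Measurable[borel X] g' ∧ g ≤ g' ∧ g' =ᵐ[μ] g := by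
  let c : ℚ → ℝ≥0∞ := fun q => (Real.toNNReal q : ℝ≥0∞)
  choose B hAB hB hBμ using fun q : ℚ =>
    hμ.exists_superset_diff_null (A := {x | c q < g x}) (measurableSet_lt measurable_const hg)
  have hle : ∀ x, g x ≤ ⨆ q, (B q).indicator (fun _ => c q) x := fun x =>
    le_of_forall_lt fun a ha => by
      obtain ⟨q, -, hq1, hq2⟩ := ENNReal.lt_iff_exists_rat_btwn.1 ha
      refine hq1.trans_le (le_iSup_of_le q ?_)
      rw [indicator_of_mem (hAB q hq2)]
  refine ⟨fun x => ⨆ q, (B q).indicator (fun _ => c q) x,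
    Measurable.iSup fun q => (@measurable_const _ _ _ (borel X) _).indicator (hB q), hle, ?_⟩
  have hae : ∀ᵐ x ∂μ, ∀ q, x ∉ B q \ {x | c q < g x} :=
    ae_all_iff.2 fun q => measure_eq_zero_iff_ae_notMem.1 (hBμ q)
  filter_upwards [hae] with x hx
  refine le_antisymm (iSup_le fun q => ?_) (hle x)
  by_cases h : x ∈ B q
  · rw [indicator_of_mem h]
    by_contra hlt
    exact hx q ⟨h, fun h' => hlt (le_of_lt h')⟩
  · rw [indicator_of_notMem h]
    exact zero_le

/-- A Hajłasz gradient has a Borel version for which the Hajłasz inequality holds everywhere. -/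
theorem IsHajlaszGradient.exists_borel_everywhere [SigmaFinite μ] (hμ : IsBorelRegular μ)
    {f : X → ℝ} {g : X → ℝ≥0∞} (h : IsHajlaszGradient μ f g) :
    ∃ g' : X → ℝ≥0∞, Measurable[borel X] g' ∧ g' =ᵐ[μ] g ∧
      ∀ x y, edist (f x) (f y) ≤ (g' x + g' y) * edist x y := by
  obtain ⟨hg, E, hE, hE0, H⟩ := h
  obtain ⟨g₀, hg₀, hle, hae⟩ := hμ.exists_borel_ge hg
  obtain ⟨B, hEB, hB, hBμ⟩ := hμ E hE
  rw [hE0] at hBμ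
  -- Adding `∞` on a Borel null set makes the inequality trivial at the exceptional points.
  let χ : X → ℝ≥0∞ := B.indicator fun _ => ∞
  have hχ : ∀ x ∈ E, χ x = ∞ := fun x hx => indicator_of_mem (hEB hx) _
  refine ⟨g₀ + χ, hg₀.add ((@measurable_const _ _ _ (borel X) ∞).indicator hB), ?_,
    fun x y => ?_⟩
  · filter_upwards [hae, measure_eq_zero_iff_ae_notMem.1 hBμ] with x hx hxB
    rw [Pi.add_apply, hx, show χ x = 0 from indicator_of_notMem hxB _, add_zero]
  by_cases hxy : x = y
  · simp [hxy]
  have hd : edist x y ≠ 0 := (edist_pos.2 hxy).ne'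
  by_cases hx : x ∈ E
  · simp [hχ x hx, hd]
  by_cases hy : y ∈ E
  · simp [hχ y hy, hd]
  rw [edist_comm, edist_dist, Real.dist_eq]
  refine (H x hx y hy).trans ?_
  gcongr
  · exact (hle x).trans le_self_add
  · exact (hle y).trans le_self_add

theorem hajlaszGradients_congr {f f' : X → ℝ} (h : f =ᵐ[μ] f') :
    hajlaszGradients μ f = hajlaszGradients μ f' :=
  Set.ext fun _ => ⟨fun hg => IsHajlaszGradient.congr hg h,
    fun hg => IsHajlaszGradient.congr hg h.symm⟩

end BorelMajorant

section

variable {X : Type*} [MetricSpace X] [MeasurableSpace X] {μ : Measure X}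

theorem IsWeakUpperSGradient.of_forall_isNontrivial {p : ℝ≥0∞} [Fact (1 ≤ p)] [Fact (p ≠ ∞)]
    {f : X → ℝ} {g : X → ℝ≥0∞}
    (hg : Measurable[borel X] g) (h : ∀ γ : TestCurve X, γ.IsNontrivial →
      ENNReal.ofReal |f (γ 1) - f (γ 0)| ≤ γ.symmIntegral g) : IsWeakUpperSGradient μ p f g :=
  ⟨hg, modulus_eq_zero_of_symmIntegral_eq_top (@measurable_const _ _ _ (borel X) 0)
    (by rw [eLpNorm_zero']; exact ENNReal.zero_lt_top) fun γ hγ => absurd (h γ hγ.1) hγ.2⟩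

end

/-! ### Comparison of the two gradient infima. -/

section Comparison

variable {X : Type*} [MetricSpace X] [MeasurableSpace X] [OpensMeasurableSpace X]
  {μ : Measure X} {p : ℝ≥0∞} [Fact (1 ≤ p)] [Fact (p ≠ ∞)]

theorem IsHajlaszGradient.exists_representative [SigmaFinite μ] (hμ : IsBorelRegular μ)
    {f : X → ℝ} {g : X → ℝ≥0∞} (h : IsHajlaszGradient μ f g) (hgp : eLpNorm g p μ < ∞) :
    ∃ F : X → ℝ, Measurable F ∧ F =ᵐ[μ] f ∧ ∃ G, IsWeakUpperSGradient μ p F G ∧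
      eLpNorm G p μ ≤ 20 * eLpNorm g p μ := by
  obtain ⟨g', hg', hae, H⟩ := h.exists_borel_everywhere hμ
  obtain ⟨F, hF, hFf, hFγ⟩ := exists_borel_representative hg' H
  have h20 : ‖(20 : ℝ)‖ₑ = 20 := by
    rw [Real.enorm_eq_ofReal (by norm_num)]
    norm_num
  have hnorm : eLpNorm g' p μ = eLpNorm g p μ := eLpNorm_congr_ae hae
  refine ⟨F, hF.mono OpensMeasurableSpace.borel_le le_rfl, ?_, fun x => ‖(20 : ℝ)‖ₑ * g' x,
    IsWeakUpperSGradient.of_forall_isNontrivial (hg'.const_mul _) fun γ hγ => ?_, ?_⟩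
  · filter_upwards [ae_lt_top_of_eLpNorm_lt_top (Measurable.of_borel hg') (hnorm ▸ hgp)]
      with x hx using hFf x hx
  · have := hFγ γ hγ
    rw [edist_dist, Real.dist_eq] at this
    refine this.trans (γ.symmIntegral_mono fun x => le_of_eq ?_)
    rw [h20, ← mul_assoc]
    norm_num
  · rw [← h20, ← hnorm]
    exact eLpNorm_const_mul_le_ennreal _ _

theorem infLpNorm_hajlaszGradients_le (f : X → ℝ) :
    infLpNorm μ p (hajlaszGradients μ f) ≤ infLpNorm μ p (weakUpperSGradients μ p f) :=
  biInf_mono fun _ hg => IsWeakUpperSGradient.isHajlaszGradient hg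

/-- Membership of `f` in the Newtonian class is essential: only then does `f` minus the good
representative `F` have some weak gradient in `L^p`, and hence the weak gradient `0`. -/
theorem infLpNorm_weakUpperSGradients_le [SigmaFinite μ] (hμ : IsBorelRegular μ) {f : X → ℝ}
    (hf : f ∈ tcNewtonianSubmodule μ p) :
    infLpNorm μ p (weakUpperSGradients μ p f) ≤ 20 * infLpNorm μ p (hajlaszGradients μ f) := by
  obtain ⟨hfm, hfp, g₀, hg₀, hg₀p⟩ := hf
  unfold infLpNorm
  simp only [ENNReal.mul_iInf_of_ne (a := 20) (by simp) (by simp)]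
  refine le_iInf₂ fun g hg => ?_
  by_cases hgp : eLpNorm g p μ < ∞
  swap
  · rw [not_lt_top_iff.1 hgp, ENNReal.mul_top (by simp)]
    exact le_top
  obtain ⟨F, hF, hFf, G, hG, hGp⟩ := IsHajlaszGradient.exists_representative (p := p) hμ hg hgp
  have hGfin : eLpNorm G p μ < ∞ := hGp.trans_lt (ENNReal.mul_lt_top (by simp) hgp)
  -- The norm of `g₀` need only be finite here; it does not enter the final bound.
  have hu := IsWeakUpperSGradient.add hg₀ (hG.smul (-1))
  have hu0 : f + (-1 : ℝ) • F =ᵐ[μ] 0 := by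
    filter_upwards [hFf] with x hx
    simp [hx]
  have hzero := hu.zero_of_ae_eq_zero hμ (hfm.add (hF.const_smul (-1 : ℝ))) hu0
    ((eLpNorm_add_le_borel (Measurable.of_borel hg₀.1)
      (Measurable.of_borel (hG.smul (-1)).1)).trans_lt (ENNReal.add_lt_top.2
        ⟨hg₀p, (eLpNorm_const_mul_le_ennreal _ _).trans_lt
          (ENNReal.mul_lt_top enorm_lt_top hGfin)⟩))
  have hsum := hG.add hzero
  rw [add_zero, show F + (f + (-1 : ℝ) • F) = f by ext x; simp] at hsum
  exact iInf₂_le_of_le G hsum hGp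

end Comparison

/-! ### The isomorphism. -/

section Isomorphism

variable {X : Type*} [MetricSpace X] [MeasurableSpace X] [OpensMeasurableSpace X]
  {μ : Measure X} {p : ℝ≥0∞} [Fact (1 ≤ p)] [Fact (p ≠ ∞)]

theorem TCNewtonianPre.memLp (f : TCNewtonianPre μ p) : MemLp f.fn p μ :=
  ⟨(Subtype.property f).1.aestronglyMeasurable, (Subtype.property f).2.1⟩

/-- The map sending a function to its almost everywhere equivalence class. -/
def TCNewtonianPre.toHajlaszSobolev : TCNewtonianPre μ p →ₗ[ℝ] HajlaszSobolev μ p where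
  toFun f := (⟨f.memLp.toLp f.fn, by
    obtain ⟨-, -, g, hg, hgp⟩ := Subtype.property f
    exact ⟨g, (IsWeakUpperSGradient.isHajlaszGradient hg).congr f.memLp.coeFn_toLp.symm, hgp⟩⟩ :
      hajlaszSobolevSubmodule μ p)
  map_add' _ _ := rfl
  map_smul' _ _ := rfl

theorem TCNewtonianPre.toLp_toHajlaszSobolev (f : TCNewtonianPre μ p) :
    f.toHajlaszSobolev.toLp = f.memLp.toLp f.fn := rfl

theorem TCNewtonianPre.norm_toHajlaszSobolev (f : TCNewtonianPre μ p) :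
    ‖f.toHajlaszSobolev‖ =
      (eLpNorm f.fn p μ).toReal + (infLpNorm μ p (hajlaszGradients μ f.fn)).toReal := by
  rw [HajlaszSobolev.norm_def, f.toLp_toHajlaszSobolev, Lp.norm_toLp,
    hajlaszGradients_congr f.memLp.coeFn_toLp]

theorem TCNewtonianPre.norm_toHajlaszSobolev_le (f : TCNewtonianPre μ p) :
    ‖f.toHajlaszSobolev‖ ≤ ‖f‖ := by
  rw [f.norm_toHajlaszSobolev, TCNewtonianPre.norm_def]
  gcongr
  · exact f.infLpNorm_lt_top'.ne
  · exact infLpNorm_hajlaszGradients_le _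

theorem TCNewtonianPre.norm_le_norm_toHajlaszSobolev [SigmaFinite μ] (hμ : IsBorelRegular μ)
    (f : TCNewtonianPre μ p) : ‖f‖ ≤ 20 * ‖f.toHajlaszSobolev‖ := by
  rw [f.norm_toHajlaszSobolev, TCNewtonianPre.norm_def, mul_add]
  refine add_le_add (le_mul_of_one_le_left ENNReal.toReal_nonneg (by norm_num)) ?_
  have hfin := (infLpNorm_hajlaszGradients_le f.fn).trans_lt f.infLpNorm_lt_top'
  have := ENNReal.toReal_mono (ENNReal.mul_lt_top (by simp) hfin).ne
    (infLpNorm_weakUpperSGradients_le hμ (Subtype.property f))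
  rwa [ENNReal.toReal_mul, ENNReal.toReal_ofNat] at this

theorem TCNewtonianPre.toHajlaszSobolev_surjective [SigmaFinite μ] (hμ : IsBorelRegular μ) :
    Function.Surjective (TCNewtonianPre.toHajlaszSobolev (μ := μ) (p := p)) := by
  intro h
  obtain ⟨g, hg, hgp⟩ := Subtype.property h
  obtain ⟨F, hF, hFf, G, hG, hGp⟩ := IsHajlaszGradient.exists_representative (p := p) hμ hg hgp
  have hmem : F ∈ tcNewtonianSubmodule μ p :=
    ⟨hF, (eLpNorm_congr_ae hFf).trans_lt (Lp.eLpNorm_lt_top _), G, hG,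
      hGp.trans_lt (ENNReal.mul_lt_top (by simp) hgp)⟩
  let f : TCNewtonianPre μ p := (⟨F, hmem⟩ : tcNewtonianSubmodule μ p)
  exact ⟨f, Subtype.ext (Lp.ext (f.memLp.coeFn_toLp.trans hFf))⟩

/-- The map induced by `TCNewtonianPre.toHajlaszSobolev` on the TC-Newtonian space. -/
def TCNewtonian.toHajlaszSobolev : TCNewtonian μ p →L[ℝ] HajlaszSobolev μ p :=
  SeparationQuotient.liftCLM
    (TCNewtonianPre.toHajlaszSobolev.mkContinuous 1 fun f => by
      rw [one_mul]; exact f.norm_toHajlaszSobolev_le)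
    fun _ _ h => (h.map (ContinuousLinearMap.continuous _)).eq

theorem TCNewtonian.norm_toHajlaszSobolev_le (q : TCNewtonian μ p) :
    ‖TCNewtonian.toHajlaszSobolev q‖ ≤ ‖q‖ := by
  obtain ⟨f, rfl⟩ := SeparationQuotient.surjective_mk q
  exact f.norm_toHajlaszSobolev_le

theorem TCNewtonian.norm_le_norm_toHajlaszSobolev [SigmaFinite μ] (hμ : IsBorelRegular μ)
    (q : TCNewtonian μ p) : ‖q‖ ≤ 20 * ‖TCNewtonian.toHajlaszSobolev q‖ := by
  obtain ⟨f, rfl⟩ := SeparationQuotient.surjective_mk q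
  exact f.norm_le_norm_toHajlaszSobolev hμ

theorem TCNewtonian.toHajlaszSobolev_bijective [SigmaFinite μ] (hμ : IsBorelRegular μ) :
    Function.Bijective (TCNewtonian.toHajlaszSobolev (μ := μ) (p := p)) := by
  -- Injectivity comes from the lower norm bound; surjectivity from the good representative of a
  -- Hajłasz–Sobolev function.
  refine ⟨(injective_iff_map_eq_zero _).2 fun q hq => ?_, fun h => ?_⟩
  · have := TCNewtonian.norm_le_norm_toHajlaszSobolev hμ q
    rw [hq, norm_zero, mul_zero] at this
    exact norm_le_zero_iff.1 this
  · obtain ⟨f, rfl⟩ := TCNewtonianPre.toHajlaszSobolev_surjective hμ h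
    exact ⟨SeparationQuotient.mk f, rfl⟩

end Isomorphism

end

theorem mainTheorem3 {X : Type*} [MetricSpace X] [MeasurableSpace X] [OpensMeasurableSpace X]
    (μ : Measure X) [SigmaFinite μ] (hμ : IsBorelRegular μ)
    (p : ℝ≥0∞) [Fact (1 ≤ p)] [Fact (p ≠ ∞)] :
    ∃ e : TCNewtonian μ p ≃L[ℝ] HajlaszSobolev μ p,
      ∀ f : TCNewtonianPre μ p, (e (SeparationQuotient.mk f)).toLp =ᵐ[μ] f.fn := by
  let e := LinearEquiv.ofBijective (TCNewtonian.toHajlaszSobolev (μ := μ) (p := p)).toLinearMap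
    (TCNewtonian.toHajlaszSobolev_bijective hμ)
  refine ⟨e.toContinuousLinearEquivOfBounds 1 20 (fun q => ?_) (fun h => ?_),
    fun f => f.memLp.coeFn_toLp⟩
  · rw [one_mul]
    exact TCNewtonian.norm_toHajlaszSobolev_le q
  · have := TCNewtonian.norm_le_norm_toHajlaszSobolev hμ (e.symm h)
    rwa [show TCNewtonian.toHajlaszSobolev (e.symm h) = h from e.apply_symm_apply h] at this
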